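/- **Setting.** Let $d,T\ge 1$ and let $\mathcal X,\mathcal Y\subset\mathbb R^d$ be compact, with $D=\max\{\sup_{x_1,x_2\in\mathcal X}\|x_1-x_2\|_2,\ \sup_{y_1,y_2\in\mathcal Y}\|y_1-y_2\|_2\}$. Let $\bar{\mathcal X},\bar{\mathcal Y}$ be the convex hulls of $\mathcal X,\mathcal Y$ (so $\bar{\mathcal X}=\mathcal X$, $\bar{\mathcal Y}=\mathcal Y$ when these sets are convex). Let $f:\bar{\mathcal X}\times\bar{\mathcal Y}\to\mathbb R$ be convex in $x$, concave in $y$ and differentiable in each variable, and let $\nabla_x f,\nabla_y f$ be its partial gradients (derivatives relative to $\bar{\mathcal X}$, $\bar{\mathcal Y}$; any choice satisfying the next inequality if a hull has empty interior). Suppose that for some $L\ge 0$ and all $x,x'\in\bar{\mathcal X}$, $y,y'\in\bar{\mathcal Y}$ $$\|\nabla_x f(x,y)-\nabla_x f(x',y')\|_2+\|\nabla_y f(x,y)-\nabla_y f(x',y')\|_2\le L\|x-x'\|_2+L\|y-y'\|_2 .$$ **Algorithm.** Put $\eta=6dD(L+1)$ and $m=T$. In each round $t=1,\dots,T$ the following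 is done. All the perturbations $\tilde\sigma^1_{t,j},\tilde\sigma^2_{t,j},\sigma^1_{t,j},\sigma^2_{t,j}$ ($1\le t\le T$, $1\le j\le m$) are independent and uniformly distributed over $\{z\in\mathbb R^d:\|z\|_2\le(1+d^{-1})\eta\}$. 1. Zero-guess predictions: almost surely $$\tilde x_{t-1,j}\in\operatorname*{argmin}_{x\in\mathcal X}\Big\langle\sum_{i=1}^{t-1}\nabla_xf(x_i,y_i)-\tilde\sigma^1_{t,j},x\Big\rangle,\quad \tilde y_{t-1,j}\in\operatorname*{argmax}_{y\in\mathcal Y}\Big\langle\sum_{i=1}^{t-1}\nabla_yf(x_i,y_i)+\tilde\sigma^2_{t,j},y\Big\rangle,$$ and $\tilde x_{t-1}=\frac1m\sum_j\tilde x_{t-1,j}$, $\tilde y_{t-1}=\frac1m\sum_j\tilde y_{t-1,j}$. 2. Guesses: $g^x_t=\nabla_xf(\tilde x_{t-1},\tilde y_{t-1})$, $g^y_t=\nabla_yf(\tilde x_{t-1},\tilde y_{t-1})$. 3. Actions: almost surely $$x_{t,j}\in\operatorname*{argmin}_{x\in\mathcal X}\Big\langle\sum_{i=1}^{t-1}\nabla_xf(x_i,y_i)+g^x_t-\sigma^1_{t,j},x\Big\rangle,\quad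 y_{t,j}\in\operatorname*{argmax}_{y\in\mathcal Y}\Big\langle\sum_{i=1}^{t-1}\nabla_yf(x_i,y_i)+g^y_t+\sigma^2_{t,j},y\Big\rangle,$$ and the players play $x_t=\frac1m\sum_jx_{t,j}$, $y_t=\frac1m\sum_jy_{t,j}$. **Theorem.** There is a universal constant $C>0$ (independent of $d,T,\mathcal X,\mathcal Y,f,L$, of the choice of optimizers and of the probability space) such that, in the above setting, the expectations below exist and $$\sup_{x\in\mathcal X,\,y\in\mathcal Y}\mathbb E\Big[f\Big(\frac1T\sum_{t=1}^Tx_t,\,y\Big)-f\Big(x,\,\frac1T\sum_{t=1}^Ty_t\Big)\Big]\le C\,\frac{dD^2(L+1)}{T}.$$ If instead the guesses of the first round are $g^x_1=g^y_1=0$ (all else unchanged) and $G$ is a number with $\|\nabla_xf\|_2\le G$ and $\|\nabla_yf\|_2\le G$ on $\bar{\mathcal X}\times\bar{\mathcal Y}$, then the left-hand side is at most $C\,\dfrac{dD^2(L+1)+DG}{T}$. -/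

import Mathlib

open MeasureTheory ProbabilityTheory
open scoped InnerProductSpace ProbabilityTheory

noncomputable section

/-- `ℝ^d` with the Euclidean norm. -/
abbrev Vec (d : ℕ) : Type := EuclideanSpace ℝ (Fin d)

/-- Minimizers of the linear function `⟪v, ·⟫` over `X`. -/
def linArgmin {d : ℕ} (X : Set (Vec d)) (v : Vec d) : Set (Vec d) :=
  {x | x ∈ X ∧ ∀ z ∈ X, ⟪v, x⟫_ℝ ≤ ⟪v, z⟫_ℝ}

/-- Maximizers of the linear function `⟪v, ·⟫` over `Y`. -/
def linArgmax {d : ℕ} (Y : Set (Vec d)) (v : Vec d) : Set (Vec d) :=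
  {y | y ∈ Y ∧ ∀ z ∈ Y, ⟪v, z⟫_ℝ ≤ ⟪v, y⟫_ℝ}

/-- The uniform distribution over the closed Euclidean ball of radius `r` around the origin;
for `r = 0` the ball is the single point `0`. -/
def uniformBall (d : ℕ) (r : ℝ) : Measure (Vec d) :=
  if r = 0 then Measure.dirac 0
  else (volume : Measure (Vec d))[|Metric.closedBall (0 : Vec d) r]

/-- The larger of the two Euclidean diameters. -/
def gameDiam {d : ℕ} (X Y : Set (Vec d)) : ℝ :=
  max (Metric.diam X) (Metric.diam Y)

/-- A smooth convex-concave game on compact `X` and `Y`, with partial gradients `gx`, `gy`.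
The actions played are averages of points of `X` (of `Y`), so `f` lives on the convex hulls;
these are `X` and `Y` themselves when `X` and `Y` are convex. -/
structure IsSmoothConvexConcaveGame {d : ℕ} (X Y : Set (Vec d)) (f : Vec d → Vec d → ℝ)
    (gx gy : Vec d → Vec d → Vec d) (L : ℝ) : Prop where
  isCompact_X : IsCompact X
  isCompact_Y : IsCompact Y
  convex_x : ∀ y ∈ convexHull ℝ Y, ConvexOn ℝ (convexHull ℝ X) (fun x => f x y)
  concave_y : ∀ x ∈ convexHull ℝ X, ConcaveOn ℝ (convexHull ℝ Y) (fun y => f x y)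
  grad_x : ∀ x ∈ convexHull ℝ X, ∀ y ∈ convexHull ℝ Y,
    HasGradientWithinAt (fun x' => f x' y) (gx x y) (convexHull ℝ X) x
  grad_y : ∀ x ∈ convexHull ℝ X, ∀ y ∈ convexHull ℝ Y,
    HasGradientWithinAt (fun y' => f x y') (gy x y) (convexHull ℝ Y) y
  smooth : ∀ x ∈ convexHull ℝ X, ∀ x' ∈ convexHull ℝ X,
    ∀ y ∈ convexHull ℝ Y, ∀ y' ∈ convexHull ℝ Y,
    ‖gx x y - gx x' y'‖ + ‖gy x y - gy x' y'‖ ≤ L * ‖x - x'‖ + L * ‖y - y'‖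

/-- The two players of the game. -/
inductive Player
  | minimizer
  | maximizer

/-- In each round perturbations are sampled twice: for the zero-guess predictions from which the
guesses are formed, and afresh for the actions. -/
inductive Stage
  | guess
  | action

/-- A run, on the probability space `(Ω, μ)`, of Convex OFTPL by both players of a game with
partial gradients `gx`, `gy`, with `T` rounds and `m` samples per prediction. Round `t : Fin T` is
the `(t+1)`-st iteration. -/
structure OFTPLRun {d : ℕ} (X Y : Set (Vec d)) (gx gy : Vec d → Vec d → Vec d)
    (P₁ P₂ : Measure (Vec d)) (T m : ℕ) {Ω : Type*} [MeasurableSpace Ω] (μ : Measure Ω) where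
  /-- the perturbations -/
  σ : Player → Stage → Fin T → Fin m → Ω → Vec d
  /-- the guesses of the next gradients -/
  guessX : Fin T → Ω → Vec d
  guessY : Fin T → Ω → Vec d
  /-- the individual optimizers computed in round `t` with the zero guess -/
  xTildeSample : Fin T → Fin m → Ω → Vec d
  yTildeSample : Fin T → Fin m → Ω → Vec d
  /-- the individual optimizers computed in round `t` with the guesses -/
  xSample : Fin T → Fin m → Ω → Vec d
  ySample : Fin T → Fin m → Ω → Vec d
  /-- the averaged zero-guess predictions -/
  xTilde : Fin T → Ω → Vec d
  yTilde : Fin T → Ω → Vec d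
  /-- the actions played -/
  x : Fin T → Ω → Vec d
  y : Fin T → Ω → Vec d
  measurable_σ : ∀ p s t j, Measurable (σ p s t j)
  law_minimizer : ∀ s t j, μ.map (σ .minimizer s t j) = P₁
  law_maximizer : ∀ s t j, μ.map (σ .maximizer s t j) = P₂
  indep : iIndepFun
    (fun (i : Player × Stage × Fin T × Fin m) => σ i.1 i.2.1 i.2.2.1 i.2.2.2) μ
  xTildeSample_mem : ∀ t j, ∀ᵐ ω ∂μ, xTildeSample t j ω ∈
    linArgmin X ((∑ i ∈ Finset.Iio t, gx (x i ω) (y i ω)) - σ .minimizer .guess t j ω)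
  yTildeSample_mem : ∀ t j, ∀ᵐ ω ∂μ, yTildeSample t j ω ∈
    linArgmax Y ((∑ i ∈ Finset.Iio t, gy (x i ω) (y i ω)) + σ .maximizer .guess t j ω)
  xSample_mem : ∀ t j, ∀ᵐ ω ∂μ, xSample t j ω ∈
    linArgmin X ((∑ i ∈ Finset.Iio t, gx (x i ω) (y i ω)) + guessX t ω
      - σ .minimizer .action t j ω)
  ySample_mem : ∀ t j, ∀ᵐ ω ∂μ, ySample t j ω ∈
    linArgmax Y ((∑ i ∈ Finset.Iio t, gy (x i ω) (y i ω)) + guessY t ω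
      + σ .maximizer .action t j ω)
  xTilde_eq : ∀ t ω, xTilde t ω = (m : ℝ)⁻¹ • ∑ j, xTildeSample t j ω
  yTilde_eq : ∀ t ω, yTilde t ω = (m : ℝ)⁻¹ • ∑ j, yTildeSample t j ω
  x_eq : ∀ t ω, x t ω = (m : ℝ)⁻¹ • ∑ j, xSample t j ω
  y_eq : ∀ t ω, y t ω = (m : ℝ)⁻¹ • ∑ j, ySample t j ω

namespace OFTPLRun

variable {d : ℕ} {X Y : Set (Vec d)} {gx gy : Vec d → Vec d → Vec d} {P₁ P₂ : Measure (Vec d)}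
  {T m : ℕ} {Ω : Type*} [MeasurableSpace Ω] {μ : Measure Ω}

/-- In every round the guesses are the partial gradients at the zero-guess predictions made in
that round. -/
def Optimistic (R : OFTPLRun X Y gx gy P₁ P₂ T m μ) : Prop :=
  ∀ t ω, R.guessX t ω = gx (R.xTilde t ω) (R.yTilde t ω) ∧
    R.guessY t ω = gy (R.xTilde t ω) (R.yTilde t ω)

/-- As `Optimistic`, except that the guesses in the first round are zero. -/
def OptimisticZeroStart (R : OFTPLRun X Y gx gy P₁ P₂ T m μ) : Prop :=
  ∀ (t : Fin T) (ω : Ω),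
    ((t : ℕ) = 0 → R.guessX t ω = 0 ∧ R.guessY t ω = 0) ∧
    ((t : ℕ) ≠ 0 → R.guessX t ω = gx (R.xTilde t ω) (R.yTilde t ω) ∧
      R.guessY t ω = gy (R.xTilde t ω) (R.yTilde t ω))

/-- `(1/T) ∑ x_t` -/
def xAvg (R : OFTPLRun X Y gx gy P₁ P₂ T m μ) (ω : Ω) : Vec d :=
  (T : ℝ)⁻¹ • ∑ t, R.x t ω

/-- `(1/T) ∑ y_t` -/
def yAvg (R : OFTPLRun X Y gx gy P₁ P₂ T m μ) (ω : Ω) : Vec d :=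
  (T : ℝ)⁻¹ • ∑ t, R.y t ω

end OFTPLRun

end

/-!
Both players follow a perturbed leader, and the expected leader is a smooth regularized leader.
For a compact set `K`, the support function `supportFn K` is Lipschitz, hence differentiable almost
everywhere, and at such a point its gradient `linMaximizer K` is the only maximizer. So with
perturbations of absolutely continuous law the optimizers are almost surely determined by the
perturbations, which gives their measurability and, by Fubini, their conditional means
`meanLeader K P`. These means are, up to sign, gradients of the convex potential
`smoothedSupport K P`. For perturbations uniform on a ball of radius `r` they are Lipschitz with
constant `d * diam K / r`, since two balls whose centres are `h` apart differ in at most a fraction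
`d * h / (2 * r)` of their volume (`volume_closedBall_diff_le`, `norm_meanLeader_sub_le`). The
radius of the algorithm makes this constant at most `1 / (6 * (L + 1))`.

The maximizing player is a minimizing player with loss vectors `-∇_y f`. For each player, smoothness
of the potential and co-coercivity of its gradient bound the loss of the expected leader in one
round by the drop of the potential, plus the squared error of the guess, minus the squared movement
that the guess causes (`inner_optimistic_le`). The potential drops telescope, and in total cost at
most `r * D` more than the comparator (`smoothedSupport_zero_sub_le`). Because the gradients are
`L`-Lipschitz, the errors of the guesses of both players are bounded by `L` times the movements and
the sampling noise, and the movements cancel against the negative terms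
(`IsSmoothConvexConcaveGame.optimistic_round_le`).

What remains is sampling noise. The averages of `m` samples deviate from their conditional means by
at most `D ^ 2 / m` in mean square (`IsFresh.integral_norm_sq_average_sub_le`). The first-order
effect of the deviation on the loss has mean zero (`IsFresh.integral_inner_average_sub`), and the
rest is of second order in the deviations, because the gradients are Lipschitz
(`IsSmoothConvexConcaveGame.inner_deviation_le`). With `m = T` the noise of all rounds together
costs `O(L * D ^ 2)`. By convexity and concavity the duality gap of the averages is at most the sum
of the regrets divided by `T`. In a round with zero guesses the loss exceeds the drop of the
potential by at most `D * ‖loss‖` (`inner_zeroGuess_le`), which accounts for the term `D * G`.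
-/

/-! ### Smooth convex potentials -/

section Potential

variable {E : Type*} [NormedAddCommGroup E] [InnerProductSpace ℝ E] {H : E → ℝ} {F : E → E}
  {lam : ℝ}

/-- If `-F` selects subgradients of `H` and is Lipschitz, then `H` lies below a quadratic. The
factor `lam` instead of `lam / 2` is the price of not integrating along the segment. -/
lemma potential_le_quadratic (hsub : ∀ v w, H v + ⟪F v, v - w⟫_ℝ ≤ H w)
    (hlip : ∀ v w, ‖F v - F w‖ ≤ lam * ‖v - w‖) (a b : E) :
    H b ≤ H a + ⟪F a, a - b⟫_ℝ + lam * ‖a - b‖ ^ 2 := by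
  have h1 := hsub b a
  have h2 : ⟪F a - F b, b - a⟫_ℝ ≤ lam * ‖a - b‖ ^ 2 := by
    calc ⟪F a - F b, b - a⟫_ℝ ≤ ‖F a - F b‖ * ‖b - a‖ := real_inner_le_norm _ _
      _ ≤ lam * ‖a - b‖ * ‖a - b‖ := by
          rw [norm_sub_rev b a]; gcongr; exact hlip a b
      _ = lam * ‖a - b‖ ^ 2 := by ring
  have h3 : ⟪F a, a - b⟫_ℝ = - ⟪F a, b - a⟫_ℝ := by rw [← inner_neg_right, neg_sub]
  rw [inner_sub_left] at h2
  linarith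

/-- Co-coercivity of the gradient of a smooth convex function. -/
lemma potential_ge_of_smooth (hlam : 0 < lam) (hsub : ∀ v w, H v + ⟪F v, v - w⟫_ℝ ≤ H w)
    (hlip : ∀ v w, ‖F v - F w‖ ≤ lam * ‖v - w‖) (a b : E) :
    H a + ⟪F a, a - b⟫_ℝ + 1 / (4 * lam) * ‖F a - F b‖ ^ 2 ≤ H b := by
  -- compare both points with the gradient step `z` of length `1 / (2 * lam)` taken from `b`
  set δ := F b - F a with hδ
  set z := b + (1 / (2 * lam)) • δ with hz
  have h1 := potential_le_quadratic hsub hlip b z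
  have h2 := hsub a z
  have hbz : b - z = -((1 / (2 * lam)) • δ) := by rw [hz]; abel
  have haz : a - z = (a - b) - (1 / (2 * lam)) • δ := by rw [hz]; abel
  have hFb : F b = F a + δ := by rw [hδ]; abel
  rw [hbz, norm_neg, norm_smul, inner_neg_right, inner_smul_right, hFb, inner_add_left,
    real_inner_self_eq_norm_sq, mul_pow, Real.norm_eq_abs, sq_abs] at h1
  rw [haz, inner_sub_right, inner_smul_right] at h2
  have h3 : ‖F a - F b‖ = ‖δ‖ := norm_sub_rev _ _
  rw [h3]
  have h4 : lam * ((1 / (2 * lam)) ^ 2 * ‖δ‖ ^ 2) = 1 / (4 * lam) * ‖δ‖ ^ 2 := by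
    field_simp; ring
  have h5 : 1 / (2 * lam) * ‖δ‖ ^ 2 = 2 * (1 / (4 * lam) * ‖δ‖ ^ 2) := by
    field_simp; ring
  nlinarith

/-- One round of the optimistic leader: the loss of the prediction made with the guess `p` is paid
for by the drop of the potential and the error of the guess; the movement caused by the guess is
gained. -/
lemma inner_optimistic_le (hlam : 0 < lam) (hsub : ∀ v w, H v + ⟪F v, v - w⟫_ℝ ≤ H w)
    (hlip : ∀ v w, ‖F v - F w‖ ≤ lam * ‖v - w‖) (S p l : E) :
    ⟪l, F (S + p)⟫_ℝ ≤ H S - H (S + l) + lam * ‖l - p‖ ^ 2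
      - 1 / (4 * lam) * ‖F (S + p) - F S‖ ^ 2 := by
  have h1 := potential_le_quadratic hsub hlip (S + p) (S + l)
  have h2 := potential_ge_of_smooth hlam hsub hlip (S + p) S
  have e1 : S + p - (S + l) = p - l := by abel
  have e2 : S + p - S = p := by abel
  rw [e1, norm_sub_rev, inner_sub_right] at h1
  rw [e2] at h2
  rw [real_inner_comm]
  linarith

/-- One round without a guess. -/
lemma inner_zeroGuess_le {D : ℝ} (hsub : ∀ v w, H v + ⟪F v, v - w⟫_ℝ ≤ H w)
    (hD : ∀ v w, ‖F v - F w‖ ≤ D) (S l : E) :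
    ⟪l, F S⟫_ℝ ≤ H S - H (S + l) + D * ‖l‖ := by
  have h1 := hsub (S + l) S
  have h2 : ⟪l, F S - F (S + l)⟫_ℝ ≤ D * ‖l‖ := by
    calc _ ≤ ‖l‖ * ‖F S - F (S + l)‖ := real_inner_le_norm _ _
      _ ≤ ‖l‖ * D := by gcongr; exact hD _ _
      _ = _ := mul_comm _ _
  rw [inner_sub_right, real_inner_comm (F (S + l))] at h2
  rw [add_sub_cancel_left] at h1
  linarith

end Potential

/-- Telescoping along the partial sums of a family indexed by `Fin T`. -/
lemma sum_sub_partialSum {E : Type*} [AddCommMonoid E] (H : E → ℝ) {T : ℕ} (l : Fin T → E) :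
    ∑ t, (H (∑ i ∈ Finset.Iio t, l i) - H ((∑ i ∈ Finset.Iio t, l i) + l t))
      = H 0 - H (∑ t, l t) := by
  induction T with
  | zero => simp
  | succ n ih =>
    rw [Fin.sum_univ_castSucc, Fin.sum_univ_castSucc]
    have h1 : ∀ t : Fin n, ∑ i ∈ Finset.Iio t.castSucc, l i
        = ∑ i ∈ Finset.Iio t, l i.castSucc := by
      intro t
      rw [← Fin.map_castSuccEmb_Iio, Finset.sum_map]; rfl
    have h2 : ∑ i ∈ Finset.Iio (Fin.last n), l i = ∑ i, l (Fin.castSucc i) := by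
      rw [Fin.Iio_last_eq_map, Finset.sum_map]; rfl
    simp only [h1, h2, ih (fun i => l i.castSucc)]
    ring

/-! ### Support functions and their maximizers -/

/-- The support function of `K`. -/
noncomputable def supportFn {d : ℕ} (K : Set (Vec d)) (v : Vec d) : ℝ :=
  sSup ((fun x => ⟪v, x⟫_ℝ) '' K)

/-- The maximizer of `⟪v, ·⟫` over a compact set `K`, as the gradient of the support function. It is
meaningful where the support function is differentiable, that is for almost every `v`. -/
noncomputable def linMaximizer {d : ℕ} (K : Set (Vec d)) (v : Vec d) : Vec d :=
  gradient (supportFn K) v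

section Support

variable {d : ℕ} {K : Set (Vec d)}

lemma inner_le_supportFn (hK : IsCompact K) (v : Vec d) {x : Vec d} (hx : x ∈ K) :
    ⟪v, x⟫_ℝ ≤ supportFn K v :=
  le_csSup (hK.image (by fun_prop)).bddAbove ⟨x, hx, rfl⟩

lemma exists_inner_eq_supportFn (hK : IsCompact K) (hne : K.Nonempty) (v : Vec d) :
    ∃ x ∈ K, ⟪v, x⟫_ℝ = supportFn K v := by
  obtain ⟨x, hx, h⟩ := (hK.image (f := fun x => ⟪v, x⟫_ℝ) (by fun_prop)).sSup_mem (hne.image _)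
  exact ⟨x, hx, h⟩

lemma mem_linArgmax_iff (hK : IsCompact K) {v x : Vec d} :
    x ∈ linArgmax K v ↔ x ∈ K ∧ ⟪v, x⟫_ℝ = supportFn K v := by
  constructor
  · rintro ⟨hx, h⟩
    obtain ⟨z, hz, hzv⟩ := exists_inner_eq_supportFn hK ⟨x, hx⟩ v
    exact ⟨hx, le_antisymm (inner_le_supportFn hK v hx) (hzv ▸ h z hz)⟩
  · rintro ⟨hx, h⟩
    exact ⟨hx, fun z hz => h ▸ inner_le_supportFn hK v hz⟩

lemma linArgmin_eq_linArgmax_neg (v : Vec d) : linArgmin K v = linArgmax K (-v) := by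
  ext x
  simp [linArgmin, linArgmax]

lemma exists_lipschitzWith_supportFn (hK : IsCompact K) (hne : K.Nonempty) :
    ∃ C, LipschitzWith C (supportFn K) := by
  obtain ⟨C, hC⟩ := hK.isBounded.exists_norm_le
  refine ⟨C.toNNReal, LipschitzWith.of_le_add_mul _ fun v w => ?_⟩
  obtain ⟨x, hx, hxv⟩ := exists_inner_eq_supportFn hK hne v
  have h1 := inner_le_supportFn hK w hx
  have h2 : ⟪v - w, x⟫_ℝ ≤ C.toNNReal * dist v w := by
    calc ⟪v - w, x⟫_ℝ ≤ ‖v - w‖ * ‖x‖ := real_inner_le_norm _ _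
      _ ≤ ‖v - w‖ * C.toNNReal := by
          gcongr; exact (hC x hx).trans (Real.le_coe_toNNReal C)
      _ = _ := by rw [dist_eq_norm, mul_comm]
  rw [inner_sub_left] at h2
  linarith

lemma ae_differentiableAt_supportFn (hK : IsCompact K) (hne : K.Nonempty) :
    ∀ᵐ v, DifferentiableAt ℝ (supportFn K) v :=
  (exists_lipschitzWith_supportFn hK hne).choose_spec.ae_differentiableAt

/-- At a point of differentiability of the support function the maximizer is unique, and is the
gradient. -/
lemma eq_linMaximizer (hK : IsCompact K) {v x : Vec d}
    (hv : DifferentiableAt ℝ (supportFn K) v) (hx : x ∈ linArgmax K v) : x = linMaximizer K v := by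
  rw [mem_linArgmax_iff hK] at hx
  have hmin : IsLocalMin (fun w => supportFn K w - ⟪x, w⟫_ℝ) v :=
    Filter.Eventually.of_forall fun w => by
      have := inner_le_supportFn hK w hx.1
      have h2 := hx.2
      simp only [real_inner_comm w x, real_inner_comm v x] at this h2 ⊢
      linarith
  have h1 : HasFDerivAt (fun w => supportFn K w - ⟪x, w⟫_ℝ)
      (fderiv ℝ (supportFn K) v - innerSL ℝ x) v :=
    hv.hasFDerivAt.sub (innerSL ℝ x).hasFDerivAt
  have h2 := hmin.hasFDerivAt_eq_zero h1
  refine ext_inner_right ℝ fun w => ?_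
  rw [linMaximizer, inner_gradient_left, sub_eq_zero.1 h2]
  rfl

lemma linMaximizer_mem_linArgmax (hK : IsCompact K) (hne : K.Nonempty) {v : Vec d}
    (hv : DifferentiableAt ℝ (supportFn K) v) : linMaximizer K v ∈ linArgmax K v := by
  obtain ⟨x, hx, h⟩ := exists_inner_eq_supportFn hK hne v
  have hx' := (mem_linArgmax_iff hK).2 ⟨hx, h⟩
  rwa [← eq_linMaximizer hK hv hx']

lemma measurable_linMaximizer (K : Set (Vec d)) : Measurable (linMaximizer K) :=
  (InnerProductSpace.toDual ℝ (Vec d)).symm.continuous.measurable.comp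
    (measurable_fderiv ℝ (supportFn K))

end Support

/-! ### Convex hulls of compact sets -/

/-- By Carathéodory's theorem, the convex hull is a finite union of continuous images of products of
simplices with powers of `K`. -/
lemma isCompact_convexHull {d : ℕ} {K : Set (Vec d)} (hK : IsCompact K) :
    IsCompact (convexHull ℝ K) := by
  have hrep : convexHull ℝ K = ⋃ k ∈ Finset.range (d + 2),
      (fun p : (Fin k → ℝ) × (Fin k → Vec d) => ∑ i, p.1 i • p.2 i) ''
        (stdSimplex ℝ (Fin k) ×ˢ Set.univ.pi fun _ => K) := by
    ext x
    simp only [Set.mem_iUnion, Set.mem_image, Finset.mem_range, Set.mem_prod, Set.mem_univ_pi,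
      exists_prop, Prod.exists]
    constructor
    · intro hx
      obtain ⟨ι, _, z, w, hz, hind, hw, hw1, rfl⟩ := eq_pos_convex_span_of_mem_convexHull hx
      have hcard : Fintype.card ι ≤ d + 1 := by
        have h1 := hind.card_le_finrank_succ
        have h2 := Submodule.finrank_le (vectorSpan ℝ (Set.range z))
        rw [finrank_euclideanSpace_fin] at h2
        omega
      let e := (Fintype.equivFin ι).symm
      refine ⟨Fintype.card ι, by omega, w ∘ e, z ∘ e, ⟨⟨fun i => (hw _).le, ?_⟩, fun i => ?_⟩, ?_⟩
      · rw [← hw1]; exact e.sum_comp w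
      · exact hz ⟨_, rfl⟩
      · exact e.sum_comp fun i => w i • z i
    · rintro ⟨k, -, w, z, ⟨hw, hz⟩, rfl⟩
      exact (convex_convexHull ℝ K).sum_mem (fun i _ => hw.1 i) hw.2
        fun i _ => subset_convexHull ℝ K (hz i)
  rw [hrep]
  refine Finset.isCompact_biUnion _ fun k _ => ?_
  exact ((isCompact_stdSimplex ℝ (Fin k)).prod (isCompact_univ_pi fun _ => hK)).image
    (by fun_prop)

/-! ### Expected maximizers of a randomly perturbed linear function -/

/-- The expected value of the support function at a perturbation of `-v`. -/
noncomputable def smoothedSupport {d : ℕ} (K : Set (Vec d)) (P : Measure (Vec d)) (v : Vec d) : ℝ :=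
  ∫ s, supportFn K (s - v) ∂P

/-- The expected maximizer of a perturbation of `-⟪v, ·⟫` over `K`. -/
noncomputable def meanLeader {d : ℕ} (K : Set (Vec d)) (P : Measure (Vec d)) (v : Vec d) : Vec d :=
  ∫ s, linMaximizer K (s - v) ∂P

section Smoothing

variable {d : ℕ} {K : Set (Vec d)} {P : Measure (Vec d)} {r : ℝ}

lemma ae_differentiableAt_supportFn_sub (hK : IsCompact K) (hne : K.Nonempty) (hP : P ≪ volume)
    (v : Vec d) : ∀ᵐ s ∂P, DifferentiableAt ℝ (supportFn K) (s - v) :=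
  hP.ae_le ((measurePreserving_sub_right volume v).quasiMeasurePreserving.ae
    (ae_differentiableAt_supportFn hK hne))

lemma ae_linMaximizer_sub_mem (hK : IsCompact K) (hne : K.Nonempty) (hP : P ≪ volume)
    (v : Vec d) : ∀ᵐ s ∂P, linMaximizer K (s - v) ∈ K := by
  filter_upwards [ae_differentiableAt_supportFn_sub hK hne hP v] with s hs
  exact (linMaximizer_mem_linArgmax hK hne hs).1

lemma integrable_linMaximizer_sub [IsFiniteMeasure P] (hK : IsCompact K) (hne : K.Nonempty)
    (hP : P ≪ volume) (v : Vec d) : Integrable (fun s => linMaximizer K (s - v)) P := by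
  obtain ⟨C, hC⟩ := hK.isBounded.exists_norm_le
  refine Integrable.of_bound
    ((measurable_linMaximizer K).comp (measurable_id.sub_const v)).aestronglyMeasurable C ?_
  filter_upwards [ae_linMaximizer_sub_mem hK hne hP v] with s hs using hC _ hs

lemma integrable_supportFn_sub [IsFiniteMeasure P] (hK : IsCompact K) (hne : K.Nonempty)
    (hr : ∀ᵐ s ∂P, ‖s‖ ≤ r) (v : Vec d) : Integrable (fun s => supportFn K (s - v)) P := by
  obtain ⟨C, hC⟩ := exists_lipschitzWith_supportFn hK hne
  refine Integrable.of_bound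
    (hC.continuous.comp (continuous_id.sub continuous_const)).aestronglyMeasurable
    (‖supportFn K 0‖ + C * (r + ‖v‖)) ?_
  filter_upwards [hr] with s hs
  have h1 := hC.dist_le_mul (s - v) 0
  rw [dist_eq_norm, dist_zero_right] at h1
  have h2 : ‖s - v‖ ≤ r + ‖v‖ := (norm_sub_le _ _).trans (by gcongr)
  have h3 : ‖supportFn K (s - v)‖ ≤ ‖supportFn K 0‖ + ‖supportFn K (s - v) - supportFn K 0‖ := by
    simpa using norm_add_le (supportFn K 0) (supportFn K (s - v) - supportFn K 0)
  have h4 : (C : ℝ) * ‖s - v‖ ≤ C * (r + ‖v‖) := by gcongr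
  linarith

lemma meanLeader_mem_convexHull [IsProbabilityMeasure P] (hK : IsCompact K) (hne : K.Nonempty)
    (hP : P ≪ volume) (v : Vec d) : meanLeader K P v ∈ convexHull ℝ K := by
  refine (convex_convexHull ℝ K).integral_mem (isCompact_convexHull hK).isClosed ?_
    (integrable_linMaximizer_sub hK hne hP v)
  filter_upwards [ae_linMaximizer_sub_mem hK hne hP v] with s hs using subset_convexHull ℝ K hs

lemma norm_sub_le_diam_of_mem_convexHull (hK : IsCompact K) {x y : Vec d}
    (hx : x ∈ convexHull ℝ K) (hy : y ∈ convexHull ℝ K) : ‖x - y‖ ≤ Metric.diam K := by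
  rw [← dist_eq_norm, ← convexHull_diam]
  exact Metric.dist_le_diam_of_mem (isCompact_convexHull hK).isBounded hx hy

lemma norm_meanLeader_sub_le_diam [IsProbabilityMeasure P] (hK : IsCompact K) (hne : K.Nonempty)
    (hP : P ≪ volume) (v w : Vec d) :
    ‖meanLeader K P v - meanLeader K P w‖ ≤ Metric.diam K :=
  norm_sub_le_diam_of_mem_convexHull hK (meanLeader_mem_convexHull hK hne hP v)
    (meanLeader_mem_convexHull hK hne hP w)

/-- The expected maximizer is minus a subgradient of the smoothed support function. -/
lemma smoothedSupport_subgradient [IsProbabilityMeasure P] (hK : IsCompact K) (hne : K.Nonempty)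
    (hP : P ≪ volume) (hr : ∀ᵐ s ∂P, ‖s‖ ≤ r) (v w : Vec d) :
    smoothedSupport K P v + ⟪meanLeader K P v, v - w⟫_ℝ ≤ smoothedSupport K P w := by
  have hM := integrable_linMaximizer_sub hK hne hP v
  have hH := integrable_supportFn_sub hK hne hr v
  have e : ⟪meanLeader K P v, v - w⟫_ℝ = ∫ s, ⟪v - w, linMaximizer K (s - v)⟫_ℝ ∂P := by
    rw [integral_inner hM, real_inner_comm]; rfl
  rw [e, smoothedSupport, ← integral_add hH (hM.const_inner _)]
  refine integral_mono_ae (hH.add (hM.const_inner _)) (integrable_supportFn_sub hK hne hr w) ?_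
  filter_upwards [ae_differentiableAt_supportFn_sub hK hne hP v] with s hs
  obtain ⟨h1, h2⟩ := (mem_linArgmax_iff hK).1 (linMaximizer_mem_linArgmax hK hne hs)
  have h3 := inner_le_supportFn hK (s - w) h1
  have h4 : s - w = (s - v) + (v - w) := by abel
  rw [h4, inner_add_left, h2, ← h4] at h3
  exact h3

/-- The regularization cost: total drop of the potential against a fixed comparator. -/
lemma smoothedSupport_zero_sub_le [IsProbabilityMeasure P] (hK : IsCompact K)
    (hr : ∀ᵐ s ∂P, ‖s‖ ≤ r) (S : Vec d) {x : Vec d} (hx : x ∈ K) :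
    smoothedSupport K P 0 - smoothedSupport K P S ≤ ⟪S, x⟫_ℝ + r * Metric.diam K := by
  have hne : K.Nonempty := ⟨x, hx⟩
  have h0 := integrable_supportFn_sub hK hne hr 0
  have hS := integrable_supportFn_sub hK hne hr S
  rw [smoothedSupport, smoothedSupport, ← integral_sub h0 hS]
  have : ∫ _s, (⟪S, x⟫_ℝ + r * Metric.diam K) ∂P = ⟪S, x⟫_ℝ + r * Metric.diam K := by simp
  rw [← this]
  refine integral_mono_ae (h0.sub hS) (integrable_const _) ?_
  filter_upwards [hr] with s hs
  obtain ⟨z, hz, hzs⟩ := exists_inner_eq_supportFn hK hne s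
  have h1 := inner_le_supportFn hK (s - S) hx
  have h2 : ⟪s, z - x⟫_ℝ ≤ r * Metric.diam K := by
    refine (real_inner_le_norm _ _).trans ?_
    have := Metric.dist_le_diam_of_mem hK.isBounded hz hx
    rw [dist_eq_norm] at this
    have := norm_nonneg s
    gcongr
    linarith
  rw [inner_sub_left] at h1
  rw [inner_sub_right] at h2
  simp only [sub_zero]
  linarith

end Smoothing

/-! ### Uniform perturbations on a ball -/

section Ball

variable {d : ℕ} {r : ℝ}

lemma uniformBall_of_pos (hr : 0 < r) :
    uniformBall d r = (volume : Measure (Vec d))[|Metric.closedBall (0 : Vec d) r] :=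
  if_neg hr.ne'

lemma isProbabilityMeasure_uniformBall (hr : 0 < r) : IsProbabilityMeasure (uniformBall d r) := by
  rw [uniformBall_of_pos hr]
  exact cond_isProbabilityMeasure_of_finite (Metric.measure_closedBall_pos _ _ hr).ne'
    measure_closedBall_lt_top.ne

lemma uniformBall_absolutelyContinuous (hr : 0 < r) :
    uniformBall d r ≪ (volume : Measure (Vec d)) := by
  rw [uniformBall_of_pos hr]
  exact cond_absolutelyContinuous

lemma ae_norm_le_uniformBall (hr : 0 < r) : ∀ᵐ s ∂(uniformBall d r), ‖s‖ ≤ r := by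
  rw [uniformBall_of_pos hr]
  filter_upwards [ae_cond_mem (μ := volume) (Metric.isClosed_closedBall (x := (0 : Vec d))
    (ε := r)).measurableSet] with s hs
  simpa using hs

/-- The part of a ball that a translate of it misses; the intersection contains the ball of radius
`r - ‖v - w‖ / 2` around the midpoint. -/
lemma volume_closedBall_diff_le (hr : 0 < r) {v w : Vec d} (hvw : ‖v - w‖ ≤ 2 * r) :
    volume.real (Metric.closedBall v r \ Metric.closedBall w r)
      ≤ d / (2 * r) * ‖v - w‖ * volume.real (Metric.closedBall (0 : Vec d) r) := by
  have hfin : volume (Metric.closedBall v r) ≠ ⊤ := measure_closedBall_lt_top.ne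
  have hball : ∀ (x : Vec d) {ρ : ℝ}, 0 ≤ ρ → volume.real (Metric.closedBall x ρ)
      = ρ ^ d * volume.real (Metric.ball (0 : Vec d) 1) := by
    intro x ρ hρ
    rw [Measure.real, Measure.addHaar_closedBall _ _ hρ, ENNReal.toReal_mul,
      ENNReal.toReal_ofReal (by positivity), finrank_euclideanSpace_fin]
    rfl
  have hA := hball v hr.le
  rw [hball 0 hr.le]
  set β := volume.real (Metric.ball (0 : Vec d) 1)
  have hβ0 : 0 ≤ β := measureReal_nonneg
  set h := ‖v - w‖ with hh
  have hbern : 1 - d * (h / (2 * r)) ≤ (1 - h / (2 * r)) ^ d := by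
    have h1 : h / (2 * r) ≤ 1 := (div_le_one (by positivity)).2 hvw
    simpa [sub_eq_add_neg] using one_add_mul_le_pow (a := -(h / (2 * r))) (by linarith) d
  set c : Vec d := midpoint ℝ v w with hc
  have hsub : Metric.closedBall c (r - h / 2) ⊆ Metric.closedBall v r ∩ Metric.closedBall w r := by
    apply Set.subset_inter <;> apply Metric.closedBall_subset_closedBall'
    · rw [hc, dist_midpoint_left, dist_eq_norm, Real.norm_ofNat, ← hh]; linarith
    · rw [hc, dist_midpoint_right, dist_eq_norm, Real.norm_ofNat, ← hh]; linarith
  have hinter : (r - h / 2) ^ d * β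
      ≤ volume.real (Metric.closedBall v r ∩ Metric.closedBall w r) := by
    rw [← hball c (by linarith)]
    exact measureReal_mono hsub (measure_ne_top_of_subset Set.inter_subset_left hfin)
  have hsplit := measureReal_inter_add_sdiff (μ := (volume : Measure (Vec d)))
    (s := Metric.closedBall v r) (t := Metric.closedBall w r)
    Metric.isClosed_closedBall.measurableSet hfin
  have e : (r - h / 2) ^ d = r ^ d * (1 - h / (2 * r)) ^ d := by
    rw [← mul_pow]; congr 1; field_simp
  rw [e] at hinter
  have h5 : r ^ d * β * (1 - d * (h / (2 * r))) ≤ r ^ d * β * (1 - h / (2 * r)) ^ d := by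
    gcongr
  have h6 : (d : ℝ) / (2 * r) * h * (r ^ d * β) = r ^ d * β * (d * (h / (2 * r))) := by
    ring
  rw [h6]
  nlinarith

lemma integral_uniformBall_sub (hr : 0 < r) (g : Vec d → Vec d) (v : Vec d) :
    ∫ s, g (s - v) ∂(uniformBall d r) = (volume.real (Metric.closedBall (0 : Vec d) r))⁻¹ •
      ∫ z in Metric.closedBall (-v) r, g z := by
  rw [uniformBall_of_pos hr, ProbabilityTheory.cond, integral_smul_measure, ENNReal.toReal_inv]
  congr 1
  rw [← integral_indicator Metric.isClosed_closedBall.measurableSet,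
    ← integral_indicator Metric.isClosed_closedBall.measurableSet,
    ← integral_sub_right_eq_self (fun z => (Metric.closedBall (-v) r).indicator g z) v]
  congr 1
  ext1 s
  by_cases hs : s ∈ Metric.closedBall (0 : Vec d) r
  · rw [Set.indicator_of_mem hs, Set.indicator_of_mem]
    simpa [dist_eq_norm] using hs
  · rw [Set.indicator_of_notMem hs, Set.indicator_of_notMem]
    simpa [dist_eq_norm] using hs

/-- Stability: moving the cumulative loss changes the law of the perturbed leader only on the part
of the ball that the translation does not cover. -/
lemma norm_meanLeader_sub_le (hd : 1 ≤ d) (hr : 0 < r) {K : Set (Vec d)} (hK : IsCompact K)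
    (hne : K.Nonempty) (v w : Vec d) :
    ‖meanLeader K (uniformBall d r) v - meanLeader K (uniformBall d r) w‖
      ≤ d * Metric.diam K / r * ‖v - w‖ := by
  have := isProbabilityMeasure_uniformBall (d := d) hr
  have hP := uniformBall_absolutelyContinuous (d := d) hr
  have hd' : (1 : ℝ) ≤ d := by exact_mod_cast hd
  set D := Metric.diam K with hD
  have hD0 : 0 ≤ D := Metric.diam_nonneg
  rcases lt_or_ge (2 * r) ‖v - w‖ with hlt | hle
  · refine (norm_meanLeader_sub_le_diam hK hne hP v w).trans ?_
    rw [div_mul_eq_mul_div, le_div_iff₀ hr]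
    have : D * r ≤ d * D * r := by nlinarith [mul_nonneg hD0 hr.le]
    have : d * D * r ≤ d * D * ‖v - w‖ := by gcongr; linarith
    linarith
  obtain ⟨x₀, hx₀⟩ := hne
  have hne : K.Nonempty := ⟨x₀, hx₀⟩
  set g : Vec d → Vec d := fun z => linMaximizer K z - x₀ with hg
  have hgm : Measurable g := (measurable_linMaximizer K).sub_const x₀
  have hgD : ∀ᵐ z, ‖g z‖ ≤ D := by
    filter_upwards [ae_differentiableAt_supportFn hK hne] with z hz
    rw [← dist_eq_norm]
    exact Metric.dist_le_diam_of_mem hK.isBounded (linMaximizer_mem_linArgmax hK hne hz).1 hx₀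
  set V := volume.real (Metric.closedBall (0 : Vec d) r) with hV
  have hVpos : 0 < V :=
    ENNReal.toReal_pos (Metric.measure_closedBall_pos _ _ hr).ne' measure_closedBall_lt_top.ne
  have hF : ∀ u, meanLeader K (uniformBall d r) u
      = x₀ + V⁻¹ • ∫ z in Metric.closedBall (-u) r, g z := by
    intro u
    rw [hV, ← integral_uniformBall_sub hr, hg,
      integral_sub (integrable_linMaximizer_sub hK hne hP u) (integrable_const _)]
    simp [meanLeader]
  set A := Metric.closedBall (-v) r with hA
  set B := Metric.closedBall (-w) r with hB
  have hAm : MeasurableSet A := Metric.isClosed_closedBall.measurableSet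
  have hBm : MeasurableSet B := Metric.isClosed_closedBall.measurableSet
  have hint : ∀ u, IntegrableOn g (Metric.closedBall u r) := fun u =>
    IntegrableOn.of_bound measure_closedBall_lt_top hgm.aestronglyMeasurable D
      (ae_restrict_of_ae hgD)
  have hnorm : ‖-v - -w‖ = ‖v - w‖ := by rw [neg_sub_neg, norm_sub_rev]
  have hAB : ‖∫ z in A \ B, g z‖ ≤ D * (d / (2 * r) * ‖v - w‖ * V) := by
    refine (norm_setIntegral_le_of_norm_le_const_ae (C := D) ?_ ?_).trans ?_
    · exact (measure_mono Set.sdiff_subset).trans_lt measure_closedBall_lt_top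
    · exact ae_restrict_of_ae hgD
    · gcongr
      rw [← hnorm]
      exact volume_closedBall_diff_le hr (hnorm.trans_le hle)
  have hBA : ‖∫ z in B \ A, g z‖ ≤ D * (d / (2 * r) * ‖v - w‖ * V) := by
    refine (norm_setIntegral_le_of_norm_le_const_ae (C := D) ?_ ?_).trans ?_
    · exact (measure_mono Set.sdiff_subset).trans_lt measure_closedBall_lt_top
    · exact ae_restrict_of_ae hgD
    · gcongr
      rw [← hnorm, norm_sub_rev]
      exact volume_closedBall_diff_le hr ((norm_sub_rev _ _).trans_le (hnorm.trans_le hle))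
  have e1 := integral_inter_add_sdiff hBm (hint (-v))
  have e2 := integral_inter_add_sdiff hAm (hint (-w))
  rw [Set.inter_comm] at e2
  have e3 : meanLeader K (uniformBall d r) v - meanLeader K (uniformBall d r) w
      = V⁻¹ • ((∫ z in A \ B, g z) - ∫ z in B \ A, g z) := by
    rw [hF, hF, ← hA, ← hB, hA, ← e1, hB, ← e2, ← hA, ← hB, add_sub_add_left_eq_sub, ← smul_sub]
    congr 1
    abel
  rw [e3, norm_smul, norm_inv, Real.norm_of_nonneg hVpos.le]
  calc V⁻¹ * ‖(∫ z in A \ B, g z) - ∫ z in B \ A, g z‖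
      ≤ V⁻¹ * (D * (d / (2 * r) * ‖v - w‖ * V) + D * (d / (2 * r) * ‖v - w‖ * V)) := by
        gcongr
        exact (norm_sub_le _ _).trans (add_le_add hAB hBA)
    _ = d * D / r * ‖v - w‖ := by field_simp; ring

end Ball

/-! ### Fresh samples of the perturbed leader -/

/-- Perturbations `V j` of law `P`, each of them independent of the past `𝓐` together with the
other perturbations. -/
def IsFresh {d m : ℕ} {Ω : Type*} (P : Measure (Vec d)) (𝓐 : MeasurableSpace Ω)
    {mΩ : MeasurableSpace Ω} (V : Fin m → Ω → Vec d) (μ : Measure Ω) : Prop :=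
  ∀ j, Measurable (V j) ∧ μ.map (V j) = P ∧
    Indep (𝓐 ⊔ ⨆ k ∈ ({j}ᶜ : Set (Fin m)), MeasurableSpace.comap (V k) inferInstance)
      (MeasurableSpace.comap (V j) inferInstance) μ

section Fresh

variable {d m : ℕ} {K : Set (Vec d)} {P : Measure (Vec d)} {Ω : Type*} {𝓐 : MeasurableSpace Ω}
  {mΩ : MeasurableSpace Ω} {μ : Measure Ω}

lemma MeasureTheory.AEStronglyMeasurable.comp_measurable' {E F : Type*} [TopologicalSpace E]
    [TopologicalSpace.PseudoMetrizableSpace E] [MeasurableSpace E] [BorelSpace E]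
    [TopologicalSpace F] [TopologicalSpace.PseudoMetrizableSpace F] [SecondCountableTopology F]
    [MeasurableSpace F] [BorelSpace F] {f : Ω → E} {g : E → F} (hg : Measurable g)
    (hf : AEStronglyMeasurable[𝓐] f μ) : AEStronglyMeasurable[𝓐] (fun ω => g (f ω)) μ := by
  obtain ⟨f', hf', h⟩ := hf
  refine ⟨fun ω => g (f' ω), (hg.comp hf'.measurable).stronglyMeasurable, ?_⟩
  filter_upwards [h] with ω hω
  rw [hω]

lemma aestronglyMeasurable_finsetSum {ι : Type*} (t : Finset ι) {f : ι → Ω → Vec d}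
    (hf : ∀ i ∈ t, AEStronglyMeasurable[𝓐] (f i) μ) :
    AEStronglyMeasurable[𝓐] (fun ω => ∑ i ∈ t, f i ω) μ := by
  classical
  induction t using Finset.induction_on with
  | empty => simpa using aestronglyMeasurable_const
  | insert a t ha ih =>
    simp only [Finset.sum_insert ha]
    exact (hf a (Finset.mem_insert_self a t)).add
      (ih fun i hi => hf i (Finset.mem_insert_of_mem hi))

/-- The joint law of a quantity determined by `𝓐` and a perturbation independent of `𝓐`. -/
lemma map_prodMk_eq_prod_of_indep [IsFiniteMeasure μ] {E : Type*} [TopologicalSpace E]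
    [TopologicalSpace.PseudoMetrizableSpace E] [MeasurableSpace E] [BorelSpace E]
    (h𝓐 : 𝓐 ≤ mΩ) {V : Ω → Vec d} (hV : Measurable V) (hVP : μ.map V = P)
    (hind : Indep 𝓐 (MeasurableSpace.comap V inferInstance) μ)
    {U : Ω → E} (hU : AEStronglyMeasurable[𝓐] U μ) :
    μ.map (fun ω => (U ω, V ω)) = (μ.map U).prod P := by
  obtain ⟨U', hU', h⟩ := hU
  have h1 : IndepFun U' V μ :=
    (IndepFun_iff_Indep _ _ _).2 (indep_of_indep_of_le_left hind hU'.measurable.comap_le)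
  have hU'm : Measurable U' := hU'.measurable.mono h𝓐 le_rfl
  have h2 := (indepFun_iff_map_prod_eq_prod_map_map hU'm.aemeasurable hV.aemeasurable).1 h1
  rw [← hVP, Measure.map_congr h, ← h2]
  refine Measure.map_congr ?_
  filter_upwards [h] with ω hω
  rw [hω]

/-- With an independent perturbation of absolutely continuous law, the objective almost surely has a
unique maximizer. -/
lemma ae_differentiableAt_supportFn_of_indep [IsFiniteMeasure μ] [IsProbabilityMeasure P]
    (hK : IsCompact K) (hne : K.Nonempty) (hP : P ≪ volume)
    (h𝓐 : 𝓐 ≤ mΩ) {V : Ω → Vec d} (hV : Measurable V) (hVP : μ.map V = P)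
    (hind : Indep 𝓐 (MeasurableSpace.comap V inferInstance) μ)
    {U : Ω → Vec d} (hU : AEStronglyMeasurable[𝓐] U μ) :
    ∀ᵐ ω ∂μ, DifferentiableAt ℝ (supportFn K) (V ω - U ω) := by
  have hmap := map_prodMk_eq_prod_of_indep h𝓐 hV hVP hind hU
  have hUm : AEMeasurable U μ := (hU.mono h𝓐).aemeasurable
  have hN : MeasurableSet {p : Vec d × Vec d | ¬ DifferentiableAt ℝ (supportFn K) (p.2 - p.1)} :=
    ((measurable_snd.sub measurable_fst) (measurableSet_of_differentiableAt ℝ (supportFn K))).compl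
  have h0 : ∀ᵐ p ∂(μ.map (fun ω => (U ω, V ω))),
      DifferentiableAt ℝ (supportFn K) (p.2 - p.1) := by
    rw [hmap, ae_iff, Measure.measure_prod_null hN]
    exact Filter.Eventually.of_forall fun u =>
      ae_iff.1 (ae_differentiableAt_supportFn_sub hK hne hP u)
  exact ae_of_ae_map (hUm.prodMk hV.aemeasurable) h0

lemma measurable_meanLeader [SFinite P] : Measurable (meanLeader K P) := by
  have h : StronglyMeasurable fun p : Vec d × Vec d => linMaximizer K (p.2 - p.1) :=
    ((measurable_linMaximizer K).comp (measurable_snd.sub measurable_fst)).stronglyMeasurable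
  exact h.integral_prod_right'.measurable

/-- The deviation of a sampled leader from its mean is orthogonal to the past. -/
lemma integral_inner_linMaximizer_sub_meanLeader [IsFiniteMeasure μ] [IsProbabilityMeasure P]
    (hK : IsCompact K) (hne : K.Nonempty) (hP : P ≪ volume)
    (h𝓐 : 𝓐 ≤ mΩ) {V : Ω → Vec d} (hV : Measurable V) (hVP : μ.map V = P)
    (hind : Indep 𝓐 (MeasurableSpace.comap V inferInstance) μ)
    {U W : Ω → Vec d} (hU : AEStronglyMeasurable[𝓐] U μ) (hW : AEStronglyMeasurable[𝓐] W μ)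
    {C : ℝ} (hC : ∀ᵐ ω ∂μ, ‖W ω‖ ≤ C) :
    Integrable (fun ω => ⟪W ω, linMaximizer K (V ω - U ω) - meanLeader K P (U ω)⟫_ℝ) μ ∧
    ∫ ω, ⟪W ω, linMaximizer K (V ω - U ω) - meanLeader K P (U ω)⟫_ℝ ∂μ = 0 := by
  have hUm : AEMeasurable U μ := (hU.mono h𝓐).aemeasurable
  have hWm : AEMeasurable W μ := (hW.mono h𝓐).aemeasurable
  have hmap := map_prodMk_eq_prod_of_indep h𝓐 hV hVP hind (hU.prodMk hW)
  set φ : (Vec d × Vec d) × Vec d → ℝ :=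
    fun p => ⟪p.1.2, linMaximizer K (p.2 - p.1.1) - meanLeader K P p.1.1⟫_ℝ with hφ
  have hφm : Measurable φ := by
    refine (measurable_snd.comp measurable_fst).inner (Measurable.sub ?_ ?_)
    · exact (measurable_linMaximizer K).comp
        (measurable_snd.sub (measurable_fst.comp measurable_fst))
    · exact measurable_meanLeader.comp (measurable_fst.comp measurable_fst)
  have hpair : AEMeasurable (fun ω => ((U ω, W ω), V ω)) μ :=
    (hUm.prodMk hWm).prodMk hV.aemeasurable
  have hint : Integrable (fun ω => φ ((U ω, W ω), V ω)) μ := by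
    refine Integrable.of_bound (hφm.comp_aemeasurable hpair).aestronglyMeasurable
      (C * Metric.diam K) ?_
    filter_upwards [hC, ae_differentiableAt_supportFn_of_indep hK hne hP h𝓐 hV hVP hind hU]
      with ω hω hd
    refine (norm_inner_le_norm _ _).trans ?_
    have h1 := norm_sub_le_diam_of_mem_convexHull hK
      (subset_convexHull ℝ K (linMaximizer_mem_linArgmax hK hne hd).1)
      (meanLeader_mem_convexHull hK hne hP (U ω))
    have := (norm_nonneg _).trans hω
    gcongr
  refine ⟨hint, ?_⟩
  have e1 : ∫ ω, φ ((U ω, W ω), V ω) ∂μ = ∫ p, φ p ∂(μ.map fun ω => ((U ω, W ω), V ω)) :=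
    (integral_map hpair hφm.aestronglyMeasurable).symm
  have hint' : Integrable φ (μ.map fun ω => ((U ω, W ω), V ω)) :=
    (integrable_map_measure hφm.aestronglyMeasurable hpair).2 hint
  rw [hmap] at e1 hint'
  change ∫ ω, φ ((U ω, W ω), V ω) ∂μ = 0
  rw [e1, integral_prod _ hint']
  refine integral_eq_zero_of_ae (Filter.Eventually.of_forall fun p => ?_)
  have hM := integrable_linMaximizer_sub hK hne hP p.1
  change ∫ s, ⟪p.2, linMaximizer K (s - p.1) - meanLeader K P p.1⟫_ℝ ∂P = 0
  have hM' : Integrable (fun s => linMaximizer K (s - p.1) - meanLeader K P p.1) P :=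
    hM.sub (integrable_const _)
  rw [integral_inner hM', integral_sub hM (integrable_const _)]
  simp [meanLeader]

variable {V : Fin m → Ω → Vec d} {U : Ω → Vec d} {s : Fin m → Ω → Vec d}

lemma IsFresh.sup_le (hV : IsFresh P 𝓐 V μ) (h𝓐 : 𝓐 ≤ mΩ) (j : Fin m) :
    𝓐 ⊔ ⨆ k ∈ ({j}ᶜ : Set (Fin m)), MeasurableSpace.comap (V k) inferInstance ≤ mΩ :=
  _root_.sup_le h𝓐 (iSup₂_le fun k _ => (hV k).1.comap_le)

lemma IsFresh.ae_differentiableAt [IsFiniteMeasure μ] [IsProbabilityMeasure P]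
    (hK : IsCompact K) (hne : K.Nonempty) (hP : P ≪ volume) (h𝓐 : 𝓐 ≤ mΩ)
    (hV : IsFresh P 𝓐 V μ) (hU : AEStronglyMeasurable[𝓐] U μ) (j : Fin m) :
    ∀ᵐ ω ∂μ, DifferentiableAt ℝ (supportFn K) (V j ω - U ω) :=
  ae_differentiableAt_supportFn_of_indep hK hne hP h𝓐 (hV j).1 (hV j).2.1
    (indep_of_indep_of_le_left (hV j).2.2 le_sup_left) hU

/-- The optimizers computed by the algorithm are almost surely determined by the perturbations. -/
lemma IsFresh.sample_ae_eq [IsFiniteMeasure μ] [IsProbabilityMeasure P]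
    (hK : IsCompact K) (hne : K.Nonempty) (hP : P ≪ volume) (h𝓐 : 𝓐 ≤ mΩ)
    (hV : IsFresh P 𝓐 V μ) (hU : AEStronglyMeasurable[𝓐] U μ)
    (hs : ∀ j, ∀ᵐ ω ∂μ, s j ω ∈ linArgmax K (V j ω - U ω)) (j : Fin m) :
    s j =ᵐ[μ] fun ω => linMaximizer K (V j ω - U ω) := by
  filter_upwards [hs j, hV.ae_differentiableAt hK hne hP h𝓐 hU j] with ω h1 h2
  exact eq_linMaximizer hK h2 h1

lemma IsFresh.aestronglyMeasurable_sample [IsFiniteMeasure μ] [IsProbabilityMeasure P]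
    (hK : IsCompact K) (hne : K.Nonempty) (hP : P ≪ volume) (h𝓐 : 𝓐 ≤ mΩ)
    (hV : IsFresh P 𝓐 V μ) (hU : AEStronglyMeasurable[𝓐] U μ)
    (hs : ∀ j, ∀ᵐ ω ∂μ, s j ω ∈ linArgmax K (V j ω - U ω)) (j : Fin m) :
    AEStronglyMeasurable[𝓐 ⊔ MeasurableSpace.comap (V j) inferInstance] (s j) μ := by
  refine AEStronglyMeasurable.congr ?_ (hV.sample_ae_eq hK hne hP h𝓐 hU hs j).symm
  have h1 : Measurable[MeasurableSpace.comap (V j) inferInstance] (V j) := comap_measurable _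
  exact ((h1.mono le_sup_right le_rfl).stronglyMeasurable.aestronglyMeasurable.sub
    (hU.mono le_sup_left)).comp_measurable' (measurable_linMaximizer K)

lemma IsFresh.aestronglyMeasurable_average [IsFiniteMeasure μ] [IsProbabilityMeasure P]
    (hK : IsCompact K) (hne : K.Nonempty) (hP : P ≪ volume) (h𝓐 : 𝓐 ≤ mΩ)
    (hV : IsFresh P 𝓐 V μ) (hU : AEStronglyMeasurable[𝓐] U μ)
    (hs : ∀ j, ∀ᵐ ω ∂μ, s j ω ∈ linArgmax K (V j ω - U ω)) :
    AEStronglyMeasurable[𝓐 ⊔ ⨆ j, MeasurableSpace.comap (V j) inferInstance]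
      (fun ω => (m : ℝ)⁻¹ • ∑ j, s j ω) μ := by
  refine AEStronglyMeasurable.fun_const_smul ?_ _
  refine aestronglyMeasurable_finsetSum _ fun j _ => ?_
  exact (hV.aestronglyMeasurable_sample hK hne hP h𝓐 hU hs j).mono
    (sup_le_sup_left (le_iSup (fun j => MeasurableSpace.comap (V j) inferInstance) j) _)

lemma average_mem_convexHull (hm : 0 < m) {z : Fin m → Vec d} (hz : ∀ j, z j ∈ convexHull ℝ K) :
    (m : ℝ)⁻¹ • ∑ j, z j ∈ convexHull ℝ K := by
  rw [Finset.smul_sum]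
  refine (convex_convexHull ℝ K).sum_mem (fun _ _ => by positivity) ?_ fun j _ => hz j
  have : (m : ℝ) ≠ 0 := by positivity
  simp [this]

lemma average_sub_eq (hm : 0 < m) (z : Fin m → Vec d) (c : Vec d) :
    (m : ℝ)⁻¹ • ∑ j, z j - c = (m : ℝ)⁻¹ • ∑ j, (z j - c) := by
  have : (m : ℝ) ≠ 0 := by positivity
  rw [Finset.sum_sub_distrib, smul_sub]
  simp [← Nat.cast_smul_eq_nsmul ℝ, smul_smul, this]

/-- The deviation of the averaged samples from their conditional mean is orthogonal to the past. -/
lemma IsFresh.integral_inner_average_sub [IsFiniteMeasure μ] [IsProbabilityMeasure P]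
    (hK : IsCompact K) (hne : K.Nonempty) (hP : P ≪ volume) (h𝓐 : 𝓐 ≤ mΩ) (hm : 0 < m)
    (hV : IsFresh P 𝓐 V μ) (hU : AEStronglyMeasurable[𝓐] U μ)
    (hs : ∀ j, ∀ᵐ ω ∂μ, s j ω ∈ linArgmax K (V j ω - U ω))
    {W : Ω → Vec d} (hW : AEStronglyMeasurable[𝓐] W μ) {C : ℝ} (hC : ∀ᵐ ω ∂μ, ‖W ω‖ ≤ C) :
    Integrable (fun ω => ⟪W ω, (m : ℝ)⁻¹ • ∑ j, s j ω - meanLeader K P (U ω)⟫_ℝ) μ ∧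
    ∫ ω, ⟪W ω, (m : ℝ)⁻¹ • ∑ j, s j ω - meanLeader K P (U ω)⟫_ℝ ∂μ = 0 := by
  have key : ∀ j, Integrable (fun ω => ⟪W ω, s j ω - meanLeader K P (U ω)⟫_ℝ) μ ∧
      ∫ ω, ⟪W ω, s j ω - meanLeader K P (U ω)⟫_ℝ ∂μ = 0 := by
    intro j
    obtain ⟨h1, h2⟩ := integral_inner_linMaximizer_sub_meanLeader hK hne hP h𝓐 (hV j).1 (hV j).2.1
      (indep_of_indep_of_le_left (hV j).2.2 le_sup_left) hU hW hC
    have e : (fun ω => ⟪W ω, s j ω - meanLeader K P (U ω)⟫_ℝ) =ᵐ[μ]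
        fun ω => ⟪W ω, linMaximizer K (V j ω - U ω) - meanLeader K P (U ω)⟫_ℝ := by
      filter_upwards [hV.sample_ae_eq hK hne hP h𝓐 hU hs j] with ω hω
      rw [hω]
    exact ⟨h1.congr e.symm, (integral_congr_ae e).trans h2⟩
  have e : ∀ ω, ⟪W ω, (m : ℝ)⁻¹ • ∑ j, s j ω - meanLeader K P (U ω)⟫_ℝ
      = (m : ℝ)⁻¹ * ∑ j, ⟪W ω, s j ω - meanLeader K P (U ω)⟫_ℝ := by
    intro ω
    rw [average_sub_eq hm, inner_smul_right, inner_sum]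
  simp only [e]
  refine ⟨(integrable_finsetSum _ fun j _ => (key j).1).const_mul _, ?_⟩
  rw [integral_const_mul, integral_finsetSum _ fun j _ => (key j).1]
  simp [fun j => (key j).2]

/-- Averaging `m` independent samples reduces the variance by the factor `m`. -/
lemma IsFresh.integral_norm_sq_average_sub_le [IsProbabilityMeasure μ] [IsProbabilityMeasure P]
    (hK : IsCompact K) (hne : K.Nonempty) (hP : P ≪ volume) (h𝓐 : 𝓐 ≤ mΩ) (hm : 0 < m)
    (hV : IsFresh P 𝓐 V μ) (hU : AEStronglyMeasurable[𝓐] U μ)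
    (hs : ∀ j, ∀ᵐ ω ∂μ, s j ω ∈ linArgmax K (V j ω - U ω)) :
    Integrable (fun ω => ‖(m : ℝ)⁻¹ • ∑ j, s j ω - meanLeader K P (U ω)‖ ^ 2) μ ∧
    ∫ ω, ‖(m : ℝ)⁻¹ • ∑ j, s j ω - meanLeader K P (U ω)‖ ^ 2 ∂μ ≤ Metric.diam K ^ 2 / m := by
  set ξ : Fin m → Ω → Vec d := fun j ω => s j ω - meanLeader K P (U ω) with hξ
  have hbound : ∀ j, ∀ᵐ ω ∂μ, ‖ξ j ω‖ ≤ Metric.diam K := by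
    intro j
    filter_upwards [hs j] with ω hω
    exact norm_sub_le_diam_of_mem_convexHull hK (subset_convexHull ℝ K hω.1)
      (meanLeader_mem_convexHull hK hne hP (U ω))
  have hmeas : ∀ j, AEStronglyMeasurable (ξ j) μ := fun j =>
    ((hV.aestronglyMeasurable_sample hK hne hP h𝓐 hU hs j).mono
      (_root_.sup_le h𝓐 (hV j).1.comap_le)).sub
      ((hU.mono h𝓐).comp_measurable' measurable_meanLeader)
  have hint : ∀ j k, Integrable (fun ω => ⟪ξ j ω, ξ k ω⟫_ℝ) μ := by
    intro j k
    refine Integrable.of_bound ((hmeas j).inner (hmeas k)) (Metric.diam K * Metric.diam K) ?_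
    filter_upwards [hbound j, hbound k] with ω h1 h2
    refine (norm_inner_le_norm _ _).trans ?_
    gcongr
  -- the samples are uncorrelated: the deviation of sample `j` belongs to the past of sample `k`
  have hoff : ∀ j k, j ≠ k → ∫ ω, ⟪ξ j ω, ξ k ω⟫_ℝ ∂μ = 0 := by
    intro j k hjk
    have hle : 𝓐 ⊔ MeasurableSpace.comap (V j) inferInstance
        ≤ 𝓐 ⊔ ⨆ i ∈ ({k}ᶜ : Set (Fin m)), MeasurableSpace.comap (V i) inferInstance :=
      sup_le_sup_left (le_iSup₂ (f := fun i (_ : i ∈ ({k}ᶜ : Set (Fin m))) =>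
        MeasurableSpace.comap (V i) inferInstance) j hjk) _
    have hW : AEStronglyMeasurable[𝓐 ⊔ ⨆ i ∈ ({k}ᶜ : Set (Fin m)),
        MeasurableSpace.comap (V i) inferInstance] (ξ j) μ :=
      ((hV.aestronglyMeasurable_sample hK hne hP h𝓐 hU hs j).mono hle).sub
        ((hU.comp_measurable' measurable_meanLeader).mono le_sup_left)
    rw [← (integral_inner_linMaximizer_sub_meanLeader hK hne hP (hV.sup_le h𝓐 k) (hV k).1
      (hV k).2.1 (hV k).2.2 (hU.mono le_sup_left) hW (hbound j)).2]
    refine integral_congr_ae ?_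
    filter_upwards [hV.sample_ae_eq hK hne hP h𝓐 hU hs k] with ω hω
    simp only [hξ, hω]
  have hdiag : ∀ j, ∫ ω, ⟪ξ j ω, ξ j ω⟫_ℝ ∂μ ≤ Metric.diam K ^ 2 := by
    intro j
    have : ∫ _ω, Metric.diam K ^ 2 ∂μ = Metric.diam K ^ 2 := by simp
    rw [← this]
    refine integral_mono_ae (hint j j) (integrable_const _) ?_
    filter_upwards [hbound j] with ω hω
    rw [real_inner_self_eq_norm_sq]
    gcongr
  have e : ∀ ω, ‖(m : ℝ)⁻¹ • ∑ j, s j ω - meanLeader K P (U ω)‖ ^ 2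
      = ((m : ℝ)⁻¹) ^ 2 * ∑ j, ∑ k, ⟪ξ j ω, ξ k ω⟫_ℝ := by
    intro ω
    rw [average_sub_eq hm, norm_smul, mul_pow, Real.norm_eq_abs, sq_abs,
      ← real_inner_self_eq_norm_sq, sum_inner]
    simp only [inner_sum, hξ]
  have hint2 : ∀ j, Integrable (fun ω => ∑ k, ⟪ξ j ω, ξ k ω⟫_ℝ) μ := fun j =>
    integrable_finsetSum _ fun k _ => hint j k
  simp only [e]
  refine ⟨(integrable_finsetSum _ fun j _ => hint2 j).const_mul _, ?_⟩
  rw [integral_const_mul, integral_finsetSum _ fun j _ => hint2 j]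
  have hrow : ∀ j, ∫ ω, ∑ k, ⟪ξ j ω, ξ k ω⟫_ℝ ∂μ ≤ Metric.diam K ^ 2 := by
    intro j
    rw [integral_finsetSum _ fun k _ => hint j k,
      Finset.sum_eq_single j (fun k _ hk => hoff j k hk.symm) (by simp)]
    exact hdiag j
  have hm' : (0 : ℝ) < m := by positivity
  calc ((m : ℝ)⁻¹) ^ 2 * ∑ j, ∫ ω, ∑ k, ⟪ξ j ω, ξ k ω⟫_ℝ ∂μ
      ≤ ((m : ℝ)⁻¹) ^ 2 * ∑ _j : Fin m, Metric.diam K ^ 2 := by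
        gcongr with j; exact hrow j
    _ = Metric.diam K ^ 2 / m := by
        rw [Finset.sum_const, Finset.card_univ, Fintype.card_fin, nsmul_eq_mul]; field_simp

end Fresh

/-! ### Convex-concave games -/

/-- The gradient inequality, relative to the domain of convexity. -/
lemma ConvexOn.inner_gradientWithin_le {d : ℕ} {C : Set (Vec d)} {φ : Vec d → ℝ} {g x z : Vec d}
    (hφ : ConvexOn ℝ C φ) (hg : HasGradientWithinAt φ g C x) (hx : x ∈ C) (hz : z ∈ C) :
    ⟪g, z - x⟫_ℝ ≤ φ z - φ x := by
  have hmaps : Set.MapsTo (AffineMap.lineMap x z : ℝ → Vec d) (Set.Icc 0 1) C := fun t ht =>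
    hφ.1.lineMap_mem hx hz ht
  have hconv : ConvexOn ℝ (Set.Icc (0 : ℝ) 1) (φ ∘ (AffineMap.lineMap x z : ℝ → Vec d)) :=
    (hφ.comp_affineMap (AffineMap.lineMap x z)).subset hmaps (convex_Icc 0 1)
  have hg' := hg.hasFDerivWithinAt
  have hline : HasDerivWithinAt (AffineMap.lineMap x z : ℝ → Vec d) (z - x) (Set.Icc 0 1) 0 :=
    AffineMap.hasDerivWithinAt_lineMap
  have hderiv : HasDerivWithinAt (φ ∘ (AffineMap.lineMap x z : ℝ → Vec d)) ⟪g, z - x⟫_ℝ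
      (Set.Icc 0 1) 0 := by
    have h0 : (AffineMap.lineMap x z : ℝ → Vec d) 0 = x := AffineMap.lineMap_apply_zero x z
    rw [← h0] at hg'
    exact hg'.comp_hasDerivWithinAt 0 hline hmaps
  have := hconv.le_slope_of_hasDerivWithinAt (Set.left_mem_Icc.2 zero_le_one)
    (Set.right_mem_Icc.2 zero_le_one) zero_lt_one hderiv
  simpa [slope_def_field] using this

lemma HasGradientWithinAt.neg' {d : ℕ} {C : Set (Vec d)} {φ : Vec d → ℝ} {g x : Vec d}
    (h : HasGradientWithinAt φ g C x) : HasGradientWithinAt (fun z => -φ z) (-g) C x := by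
  rw [hasGradientWithinAt_iff_hasFDerivWithinAt, map_neg]
  exact h.hasFDerivWithinAt.fun_neg

lemma continuousOn_of_norm_sub_le {d : ℕ} {L : ℝ} {s : Set (Vec d × Vec d)}
    {g : Vec d × Vec d → Vec d}
    (h : ∀ p ∈ s, ∀ q ∈ s, ‖g q - g p‖ ≤ L * ‖q.1 - p.1‖ + L * ‖q.2 - p.2‖) :
    ContinuousOn g s := by
  intro p hp
  have hlim : Filter.Tendsto (fun q : Vec d × Vec d => L * ‖q.1 - p.1‖ + L * ‖q.2 - p.2‖)
      (nhdsWithin p s) (nhds 0) := by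
    have : Continuous fun q : Vec d × Vec d => L * ‖q.1 - p.1‖ + L * ‖q.2 - p.2‖ := by fun_prop
    simpa using (this.tendsto p).mono_left nhdsWithin_le_nhds
  refine tendsto_iff_norm_sub_tendsto_zero.2
    (squeeze_zero' (Filter.Eventually.of_forall fun _ => norm_nonneg _) ?_ hlim)
  filter_upwards [self_mem_nhdsWithin] with q hq using h p hp q hq

/-- The error of the two guesses in terms of six displacements. The factor `1 / (6 * (L + 1))` is
the Lipschitz constant of the expected leaders: it undoes the loss of a factor `6` in squaring the
sum, and one of the two factors `L`. -/
lemma sq_add_sq_le_of_add_le {L α β a b c a' b' c' : ℝ} (hL : 0 ≤ L) (hα : 0 ≤ α) (hβ : 0 ≤ β)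
    (h : α + β ≤ L * (a + b + c + (a' + b' + c'))) :
    1 / (6 * (L + 1)) * α ^ 2 + 1 / (6 * (L + 1)) * β ^ 2
      ≤ L * (a ^ 2 + b ^ 2 + c ^ 2 + a' ^ 2 + b' ^ 2 + c' ^ 2) := by
  have h2 : α ^ 2 + β ^ 2 ≤ L ^ 2 * (a + b + c + (a' + b' + c')) ^ 2 := by
    calc α ^ 2 + β ^ 2 ≤ (α + β) ^ 2 := by nlinarith [mul_nonneg hα hβ]
      _ ≤ (L * (a + b + c + (a' + b' + c'))) ^ 2 := pow_le_pow_left₀ (add_nonneg hα hβ) h 2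
      _ = _ := mul_pow _ _ _
  have h3 : (a + b + c + (a' + b' + c')) ^ 2
      ≤ 6 * (a ^ 2 + b ^ 2 + c ^ 2 + a' ^ 2 + b' ^ 2 + c' ^ 2) := by
    have := sq_sum_le_card_mul_sum_sq (s := Finset.univ) (f := ![a, b, c, a', b', c'])
    simp [Fin.sum_univ_succ] at this
    linarith
  set Q := a ^ 2 + b ^ 2 + c ^ 2 + a' ^ 2 + b' ^ 2 + c' ^ 2 with hQ
  have hQ0 : 0 ≤ Q := by positivity
  have h4 : L ^ 2 * (a + b + c + (a' + b' + c')) ^ 2 ≤ L ^ 2 * (6 * Q) := by gcongr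
  calc 1 / (6 * (L + 1)) * α ^ 2 + 1 / (6 * (L + 1)) * β ^ 2
      = (α ^ 2 + β ^ 2) / (6 * (L + 1)) := by ring
    _ ≤ L * Q := by
      rw [div_le_iff₀ (by positivity)]
      nlinarith [mul_nonneg hL hQ0]

namespace IsSmoothConvexConcaveGame

variable {d : ℕ} {X Y : Set (Vec d)} {f : Vec d → Vec d → ℝ} {gx gy : Vec d → Vec d → Vec d} {L : ℝ}

lemma inner_gradX_le (hG : IsSmoothConvexConcaveGame X Y f gx gy L) {x z y : Vec d}
    (hx : x ∈ convexHull ℝ X) (hz : z ∈ convexHull ℝ X) (hy : y ∈ convexHull ℝ Y) :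
    ⟪gx x y, z - x⟫_ℝ ≤ f z y - f x y :=
  (hG.convex_x y hy).inner_gradientWithin_le (hG.grad_x x hx y hy) hx hz

lemma le_inner_gradY (hG : IsSmoothConvexConcaveGame X Y f gx gy L) {x z y : Vec d}
    (hx : x ∈ convexHull ℝ X) (hy : y ∈ convexHull ℝ Y) (hz : z ∈ convexHull ℝ Y) :
    f x z - f x y ≤ ⟪gy x y, z - y⟫_ℝ := by
  have := (hG.concave_y x hx).neg.inner_gradientWithin_le (hG.grad_y x hx y hy).neg' hy hz
  rw [inner_neg_left] at this
  simp only [Pi.neg_apply] at this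
  linarith

/-- The duality gap of the averaged play is at most the sum of the regrets of the two players. -/
lemma gap_le_regret (hG : IsSmoothConvexConcaveGame X Y f gx gy L) {T : ℕ} (hT : 0 < T)
    {x y : Fin T → Vec d} (hx : ∀ t, x t ∈ convexHull ℝ X) (hy : ∀ t, y t ∈ convexHull ℝ Y)
    {x₀ y₀ : Vec d} (hx₀ : x₀ ∈ X) (hy₀ : y₀ ∈ Y) :
    T * (f ((T : ℝ)⁻¹ • ∑ t, x t) y₀ - f x₀ ((T : ℝ)⁻¹ • ∑ t, y t))
      ≤ ∑ t, (⟪gx (x t) (y t), x t - x₀⟫_ℝ + ⟪-gy (x t) (y t), y t - y₀⟫_ℝ) := by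
  have hx₀' := subset_convexHull ℝ X hx₀
  have hy₀' := subset_convexHull ℝ Y hy₀
  have hT' : (T : ℝ) ≠ 0 := by positivity
  have hsum : ∑ _t : Fin T, (T : ℝ)⁻¹ = 1 := by simp [hT']
  have h1 : f ((T : ℝ)⁻¹ • ∑ t, x t) y₀ ≤ (T : ℝ)⁻¹ * ∑ t, f (x t) y₀ := by
    have := (hG.convex_x y₀ hy₀').map_sum_le (t := Finset.univ) (w := fun _ : Fin T => (T : ℝ)⁻¹)
      (p := x) (fun _ _ => by positivity) hsum fun t _ => hx t
    simpa only [← Finset.smul_sum, smul_eq_mul, ← Finset.mul_sum] using this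
  have h2 : (T : ℝ)⁻¹ * ∑ t, f x₀ (y t) ≤ f x₀ ((T : ℝ)⁻¹ • ∑ t, y t) := by
    have := (hG.concave_y x₀ hx₀').le_map_sum (t := Finset.univ)
      (w := fun _ : Fin T => (T : ℝ)⁻¹) (p := y) (fun _ _ => by positivity) hsum fun t _ => hy t
    simpa only [← Finset.smul_sum, smul_eq_mul, ← Finset.mul_sum] using this
  calc T * (f ((T : ℝ)⁻¹ • ∑ t, x t) y₀ - f x₀ ((T : ℝ)⁻¹ • ∑ t, y t))
      ≤ T * ((T : ℝ)⁻¹ * ∑ t, f (x t) y₀ - (T : ℝ)⁻¹ * ∑ t, f x₀ (y t)) := by gcongr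
    _ = ∑ t, (f (x t) y₀ - f x₀ (y t)) := by
        rw [Finset.sum_sub_distrib]; field_simp
    _ ≤ _ := by
        refine Finset.sum_le_sum fun t _ => ?_
        have e1 := hG.inner_gradX_le (hx t) hx₀' (hy t)
        have e2 := hG.le_inner_gradY (hx t) (hy t) hy₀'
        rw [← neg_sub x₀, inner_neg_right, inner_neg_left, ← neg_sub y₀, inner_neg_right]
        linarith

lemma continuousOn_gradX (hG : IsSmoothConvexConcaveGame X Y f gx gy L) :
    ContinuousOn (fun p : Vec d × Vec d => gx p.1 p.2) (convexHull ℝ X ×ˢ convexHull ℝ Y) := by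
  refine continuousOn_of_norm_sub_le (L := L) fun p hp q hq => ?_
  have := hG.smooth q.1 hq.1 p.1 hp.1 q.2 hq.2 p.2 hp.2
  linarith [norm_nonneg (gy q.1 q.2 - gy p.1 p.2)]

lemma continuousOn_gradY (hG : IsSmoothConvexConcaveGame X Y f gx gy L) :
    ContinuousOn (fun p : Vec d × Vec d => gy p.1 p.2) (convexHull ℝ X ×ˢ convexHull ℝ Y) := by
  refine continuousOn_of_norm_sub_le (L := L) fun p hp q hq => ?_
  have := hG.smooth q.1 hq.1 p.1 hp.1 q.2 hq.2 p.2 hp.2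
  linarith [norm_nonneg (gx q.1 q.2 - gx p.1 p.2)]

lemma isCompact_hulls (hG : IsSmoothConvexConcaveGame X Y f gx gy L) :
    IsCompact (convexHull ℝ X ×ˢ convexHull ℝ Y) :=
  (isCompact_convexHull hG.isCompact_X).prod (isCompact_convexHull hG.isCompact_Y)

/-- Playing sampled instead of expected leaders: up to a term of mean zero, the cost is of second
order in the deviations, since the gradients move by no more than the deviations do. -/
lemma inner_deviation_le (hG : IsSmoothConvexConcaveGame X Y f gx gy L) (hL : 0 ≤ L)
    {x u y v : Vec d} (hx : x ∈ convexHull ℝ X) (hu : u ∈ convexHull ℝ X)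
    (hy : y ∈ convexHull ℝ Y) (hv : v ∈ convexHull ℝ Y) :
    ⟪gx x y, x - u⟫_ℝ + ⟪-gy x y, y - v⟫_ℝ ≤ ⟪gx u v, x - u⟫_ℝ + ⟪-gy u v, y - v⟫_ℝ
      + 2 * L * (‖x - u‖ ^ 2 + ‖y - v‖ ^ 2) := by
  have hs := hG.smooth x hx u hu y hy v hv
  have h1 : ⟪gx x y - gx u v, x - u⟫_ℝ ≤ ‖gx x y - gx u v‖ * ‖x - u‖ := real_inner_le_norm _ _
  have h2 : ⟪gy u v - gy x y, y - v⟫_ℝ ≤ ‖gy x y - gy u v‖ * ‖y - v‖ := by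
    rw [norm_sub_rev (gy x y)]; exact real_inner_le_norm _ _
  rw [inner_sub_left] at h1 h2
  rw [inner_neg_left, inner_neg_left]
  have p1 := norm_nonneg (gx x y - gx u v)
  have p2 := norm_nonneg (gy x y - gy u v)
  have p3 := norm_nonneg (x - u)
  have p4 := norm_nonneg (y - v)
  set α := ‖gx x y - gx u v‖
  set β := ‖gy x y - gy u v‖
  set a := ‖x - u‖
  set b := ‖y - v‖
  have h3 : α * a + β * b ≤ (α + β) * (a + b) := by
    nlinarith [mul_nonneg p1 p4, mul_nonneg p2 p3]
  have h4 : (α + β) * (a + b) ≤ (L * a + L * b) * (a + b) := by gcongr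
  have h5 : (L * a + L * b) * (a + b) ≤ 2 * L * (a ^ 2 + b ^ 2) := by
    nlinarith [mul_nonneg hL (sq_nonneg (a - b))]
  linarith

section Round

variable {HX HY : Vec d → ℝ} {FX FY : Vec d → Vec d}

/-- The excess loss of one round of both players when the guesses are the gradients at the
zero-guess predictions `x'`, `y'`: the error of the guesses is, up to sampling noise, absorbed by
the stability of the leaders. -/
lemma optimistic_round_le (hG : IsSmoothConvexConcaveGame X Y f gx gy L) (hL : 0 ≤ L)
    (hsubX : ∀ v w, HX v + ⟪FX v, v - w⟫_ℝ ≤ HX w)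
    (hlipX : ∀ v w, ‖FX v - FX w‖ ≤ 1 / (6 * (L + 1)) * ‖v - w‖)
    (hsubY : ∀ v w, HY v + ⟪FY v, v - w⟫_ℝ ≤ HY w)
    (hlipY : ∀ v w, ‖FY v - FY w‖ ≤ 1 / (6 * (L + 1)) * ‖v - w‖)
    (hFX : ∀ v, FX v ∈ convexHull ℝ X) (hFY : ∀ v, FY v ∈ convexHull ℝ Y)
    (S R : Vec d) {x x' y y' : Vec d} (hx : x ∈ convexHull ℝ X) (hx' : x' ∈ convexHull ℝ X)
    (hy : y ∈ convexHull ℝ Y) (hy' : y' ∈ convexHull ℝ Y) :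
    ⟪gx x y, x⟫_ℝ + ⟪-gy x y, y⟫_ℝ ≤ (HX S - HX (S + gx x y)) + (HY R - HY (R + -gy x y))
      + (⟪gx (FX (S + gx x' y')) (FY (R + -gy x' y')), x - FX (S + gx x' y')⟫_ℝ
        + ⟪-gy (FX (S + gx x' y')) (FY (R + -gy x' y')), y - FY (R + -gy x' y')⟫_ℝ)
      + 3 * L * ((‖x - FX (S + gx x' y')‖ ^ 2 + ‖y - FY (R + -gy x' y')‖ ^ 2)
        + (‖x' - FX S‖ ^ 2 + ‖y' - FY R‖ ^ 2)) := by
  have hlam : 0 < 1 / (6 * (L + 1)) := by positivity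
  have hX := inner_optimistic_le hlam hsubX hlipX S (gx x' y') (gx x y)
  have hY := inner_optimistic_le hlam hsubY hlipY R (-gy x' y') (-gy x y)
  have hcoef : 1 / (4 * (1 / (6 * (L + 1)))) = 3 / 2 * (L + 1) := by field_simp; ring
  rw [hcoef] at hX hY
  set u := FX (S + gx x' y')
  set v := FY (R + -gy x' y')
  have hdev := hG.inner_deviation_le hL hx (hFX _ : u ∈ _) hy (hFY _ : v ∈ _)
  rw [inner_sub_right (gx x y), inner_sub_right (-gy x y)] at hdev
  have hs := hG.smooth x hx x' hx' y hy y' hy'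
  have hnegY : ‖-gy x y - -gy x' y'‖ = ‖gy x y - gy x' y'‖ := by rw [neg_sub_neg, norm_sub_rev]
  rw [hnegY] at hY
  have tX : ‖x - x'‖ ≤ ‖x - u‖ + ‖u - FX S‖ + ‖x' - FX S‖ := by
    have e : x - x' = (x - u) + (u - FX S) - (x' - FX S) := by abel
    rw [e]
    exact (norm_sub_le _ _).trans (by gcongr; exact norm_add_le _ _)
  have tY : ‖y - y'‖ ≤ ‖y - v‖ + ‖v - FY R‖ + ‖y' - FY R‖ := by
    have e : y - y' = (y - v) + (v - FY R) - (y' - FY R) := by abel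
    rw [e]
    exact (norm_sub_le _ _).trans (by gcongr; exact norm_add_le _ _)
  have p1 := norm_nonneg (gx x y - gx x' y')
  have p2 := norm_nonneg (gy x y - gy x' y')
  set α := ‖gx x y - gx x' y'‖
  set β := ‖gy x y - gy x' y'‖
  set a := ‖x - u‖
  set b := ‖y - v‖
  set c := ‖u - FX S‖
  set e := ‖v - FY R‖
  set a' := ‖x' - FX S‖
  set b' := ‖y' - FY R‖
  -- the guess errors cost at most `L` times the sum of all squared displacements
  have hguess := sq_add_sq_le_of_add_le hL p1 p2
    (show α + β ≤ L * (a + c + a' + (b + e + b')) by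
      have h1 := mul_le_mul_of_nonneg_left tX hL
      have h2 := mul_le_mul_of_nonneg_left tY hL
      linarith)
  have hc : L * c ^ 2 ≤ 3 / 2 * (L + 1) * c ^ 2 := by gcongr; linarith
  have he : L * e ^ 2 ≤ 3 / 2 * (L + 1) * e ^ 2 := by gcongr; linarith
  have ha' : 0 ≤ L * a' ^ 2 := by positivity
  have hb' : 0 ≤ L * b' ^ 2 := by positivity
  linarith

/-- The excess loss of one round of both players when the guesses are zero. -/
lemma zeroGuess_round_le (hG : IsSmoothConvexConcaveGame X Y f gx gy L) (hL : 0 ≤ L) {D : ℝ}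
    (hsubX : ∀ v w, HX v + ⟪FX v, v - w⟫_ℝ ≤ HX w)
    (hsubY : ∀ v w, HY v + ⟪FY v, v - w⟫_ℝ ≤ HY w)
    (hFX : ∀ v, FX v ∈ convexHull ℝ X) (hFY : ∀ v, FY v ∈ convexHull ℝ Y)
    (hDX : ∀ v w, ‖FX v - FX w‖ ≤ D) (hDY : ∀ v w, ‖FY v - FY w‖ ≤ D)
    (S R : Vec d) {x y : Vec d} (hx : x ∈ convexHull ℝ X) (hy : y ∈ convexHull ℝ Y) :
    ⟪gx x y, x⟫_ℝ + ⟪-gy x y, y⟫_ℝ ≤ (HX S - HX (S + gx x y)) + (HY R - HY (R + -gy x y))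
      + (⟪gx (FX S) (FY R), x - FX S⟫_ℝ + ⟪-gy (FX S) (FY R), y - FY R⟫_ℝ)
      + 2 * L * (‖x - FX S‖ ^ 2 + ‖y - FY R‖ ^ 2) + (D * ‖gx x y‖ + D * ‖gy x y‖) := by
  have hX := inner_zeroGuess_le hsubX hDX S (gx x y)
  have hY := inner_zeroGuess_le hsubY hDY R (-gy x y)
  have hdev := hG.inner_deviation_le hL hx (hFX S) hy (hFY R)
  rw [inner_sub_right (gx x y), inner_sub_right (-gy x y)] at hdev
  rw [norm_neg] at hY
  linarith

end Round

end IsSmoothConvexConcaveGame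

lemma aestronglyMeasurable_comp_continuousOn {E F Ω : Type*} [TopologicalSpace E]
    [TopologicalSpace.PseudoMetrizableSpace E] [MeasurableSpace E] [BorelSpace E]
    [NormedAddCommGroup F] [SecondCountableTopology F]
    [MeasurableSpace F] [BorelSpace F] {𝓐 mΩ : MeasurableSpace Ω} {μ : Measure Ω}
    {s : Set E} (hs : IsClosed s) {g : E → F} (hg : ContinuousOn g s)
    {u : Ω → E} (hu : AEStronglyMeasurable[𝓐] u μ) (hus : ∀ᵐ ω ∂μ, u ω ∈ s) :
    AEStronglyMeasurable[𝓐] (fun ω => g (u ω)) μ := by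
  classical
  have hm : Measurable (s.piecewise g fun _ => 0) :=
    hg.measurable_piecewise continuousOn_const hs.measurableSet
  refine (hu.comp_measurable' hm).congr ?_
  filter_upwards [hus] with ω hω
  exact Set.piecewise_eq_of_mem _ _ _ hω

/-! ### Runs of the algorithm: measurability and sampling noise -/

lemma IsSmoothConvexConcaveGame.aestronglyMeasurable_grad {d : ℕ} {X Y : Set (Vec d)}
    {f : Vec d → Vec d → ℝ} {gx gy : Vec d → Vec d → Vec d} {L : ℝ} {Ω : Type*}
    {𝓐 mΩ : MeasurableSpace Ω} {μ : Measure Ω} (hG : IsSmoothConvexConcaveGame X Y f gx gy L)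
    {x y : Ω → Vec d}
    (hx : AEStronglyMeasurable[𝓐] x μ) (hy : AEStronglyMeasurable[𝓐] y μ)
    (hxX : ∀ᵐ ω ∂μ, x ω ∈ convexHull ℝ X) (hyY : ∀ᵐ ω ∂μ, y ω ∈ convexHull ℝ Y) :
    AEStronglyMeasurable[𝓐] (fun ω => gx (x ω) (y ω)) μ ∧
      AEStronglyMeasurable[𝓐] (fun ω => gy (x ω) (y ω)) μ := by
  have hmem : ∀ᵐ ω ∂μ, (x ω, y ω) ∈ convexHull ℝ X ×ˢ convexHull ℝ Y := by
    filter_upwards [hxX, hyY] with ω h1 h2 using ⟨h1, h2⟩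
  exact ⟨aestronglyMeasurable_comp_continuousOn hG.isCompact_hulls.isClosed hG.continuousOn_gradX
      (hx.prodMk hy) hmem,
    aestronglyMeasurable_comp_continuousOn hG.isCompact_hulls.isClosed hG.continuousOn_gradY
      (hx.prodMk hy) hmem⟩

namespace OFTPLRun

variable {d : ℕ} {X Y : Set (Vec d)} {f : Vec d → Vec d → ℝ} {gx gy : Vec d → Vec d → Vec d}
  {L : ℝ} {P : Measure (Vec d)} {T m : ℕ} {Ω : Type*} [MeasurableSpace Ω] {μ : Measure Ω}

/-- The loss vector of the minimizing player in round `t`. -/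
noncomputable def lossX (R : OFTPLRun X Y gx gy P P T m μ) (t : Fin T) (ω : Ω) : Vec d :=
  gx (R.x t ω) (R.y t ω)

/-- The loss vector of the maximizing player in round `t`; the sign turns the maximizer into a
minimizer, so that both players follow the same rule. -/
noncomputable def lossY (R : OFTPLRun X Y gx gy P P T m μ) (t : Fin T) (ω : Ω) : Vec d :=
  -gy (R.x t ω) (R.y t ω)

/-- The cumulative loss of the minimizing player before round `t`. -/
noncomputable def cumX (R : OFTPLRun X Y gx gy P P T m μ) (t : Fin T) (ω : Ω) : Vec d :=
  ∑ i ∈ Finset.Iio t, R.lossX i ω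

/-- The cumulative loss of the maximizing player before round `t`. -/
noncomputable def cumY (R : OFTPLRun X Y gx gy P P T m μ) (t : Fin T) (ω : Ω) : Vec d :=
  ∑ i ∈ Finset.Iio t, R.lossY i ω

/-- The conditional mean of the action of the minimizing player, given everything that precedes
the sampling of the action. -/
noncomputable def meanX (R : OFTPLRun X Y gx gy P P T m μ) (t : Fin T) (ω : Ω) : Vec d :=
  meanLeader X P (R.cumX t ω + R.guessX t ω)

/-- The conditional mean of the action of the maximizing player. -/
noncomputable def meanY (R : OFTPLRun X Y gx gy P P T m μ) (t : Fin T) (ω : Ω) : Vec d :=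
  meanLeader Y P (R.cumY t ω + -R.guessY t ω)

/-- The guesses of round `t` are the gradients at the zero-guess predictions of that round. -/
def GuessesGradientAt (R : OFTPLRun X Y gx gy P P T m μ) (t : Fin T) : Prop :=
  ∀ ω, R.guessX t ω = gx (R.xTilde t ω) (R.yTilde t ω) ∧
    R.guessY t ω = gy (R.xTilde t ω) (R.yTilde t ω)

/-- The guesses of round `t` are zero. -/
def GuessesZeroAt (R : OFTPLRun X Y gx gy P P T m μ) (t : Fin T) : Prop :=
  ∀ ω, R.guessX t ω = 0 ∧ R.guessY t ω = 0

lemma xSample_mem_linArgmax (R : OFTPLRun X Y gx gy P P T m μ) (t : Fin T) (j : Fin m) :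
    ∀ᵐ ω ∂μ, R.xSample t j ω ∈
      linArgmax X (R.σ .minimizer .action t j ω - (R.cumX t ω + R.guessX t ω)) := by
  filter_upwards [R.xSample_mem t j] with ω hω
  rw [linArgmin_eq_linArgmax_neg, neg_sub] at hω
  exact hω

lemma ySample_mem_linArgmax (R : OFTPLRun X Y gx gy P P T m μ) (t : Fin T) (j : Fin m) :
    ∀ᵐ ω ∂μ, R.ySample t j ω ∈
      linArgmax Y (R.σ .maximizer .action t j ω - (R.cumY t ω + -R.guessY t ω)) := by
  filter_upwards [R.ySample_mem t j] with ω hω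
  convert hω using 2
  simp only [cumY, lossY, Finset.sum_neg_distrib]
  abel

lemma xTildeSample_mem_linArgmax (R : OFTPLRun X Y gx gy P P T m μ) (t : Fin T) (j : Fin m) :
    ∀ᵐ ω ∂μ, R.xTildeSample t j ω ∈
      linArgmax X (R.σ .minimizer .guess t j ω - R.cumX t ω) := by
  filter_upwards [R.xTildeSample_mem t j] with ω hω
  rw [linArgmin_eq_linArgmax_neg, neg_sub] at hω
  exact hω

lemma yTildeSample_mem_linArgmax (R : OFTPLRun X Y gx gy P P T m μ) (t : Fin T) (j : Fin m) :
    ∀ᵐ ω ∂μ, R.yTildeSample t j ω ∈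
      linArgmax Y (R.σ .maximizer .guess t j ω - R.cumY t ω) := by
  filter_upwards [R.yTildeSample_mem t j] with ω hω
  convert hω using 2
  simp only [cumY, lossY, Finset.sum_neg_distrib]
  abel

lemma ae_mem_convexHull (R : OFTPLRun X Y gx gy P P T m μ) (hm : 0 < m) :
    ∀ᵐ ω ∂μ, ∀ t, R.x t ω ∈ convexHull ℝ X ∧ R.y t ω ∈ convexHull ℝ Y ∧
      R.xTilde t ω ∈ convexHull ℝ X ∧ R.yTilde t ω ∈ convexHull ℝ Y := by
  filter_upwards [ae_all_iff.2 fun t => ae_all_iff.2 (R.xSample_mem t),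
    ae_all_iff.2 fun t => ae_all_iff.2 (R.ySample_mem t),
    ae_all_iff.2 fun t => ae_all_iff.2 (R.xTildeSample_mem t),
    ae_all_iff.2 fun t => ae_all_iff.2 (R.yTildeSample_mem t)] with ω h1 h2 h3 h4 t
  rw [R.x_eq, R.y_eq, R.xTilde_eq, R.yTilde_eq]
  exact ⟨average_mem_convexHull hm fun j => subset_convexHull ℝ X (h1 t j).1,
    average_mem_convexHull hm fun j => subset_convexHull ℝ Y (h2 t j).1,
    average_mem_convexHull hm fun j => subset_convexHull ℝ X (h3 t j).1,
    average_mem_convexHull hm fun j => subset_convexHull ℝ Y (h4 t j).1⟩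

/-- The information carried by the perturbations with index in `S`. -/
@[reducible]
def history (R : OFTPLRun X Y gx gy P P T m μ) (S : Set (Player × Stage × Fin T × Fin m)) :
    MeasurableSpace Ω :=
  ⨆ i ∈ S, MeasurableSpace.comap (R.σ i.1 i.2.1 i.2.2.1 i.2.2.2) inferInstance

lemma history_le (R : OFTPLRun X Y gx gy P P T m μ) (S : Set (Player × Stage × Fin T × Fin m)) :
    R.history S ≤ ‹MeasurableSpace Ω› :=
  iSup₂_le fun _ _ => (R.measurable_σ _ _ _ _).comap_le

lemma history_mono (R : OFTPLRun X Y gx gy P P T m μ)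
    {S S' : Set (Player × Stage × Fin T × Fin m)} (h : S ⊆ S') : R.history S ≤ R.history S' :=
  biSup_mono h

lemma comap_le_history (R : OFTPLRun X Y gx gy P P T m μ)
    {S : Set (Player × Stage × Fin T × Fin m)} {p : Player} {s : Stage} {t : Fin T} {j : Fin m}
    (h : (p, s, t, j) ∈ S) : MeasurableSpace.comap (R.σ p s t j) inferInstance ≤ R.history S :=
  le_iSup₂ (f := fun (i : Player × Stage × Fin T × Fin m) (_ : i ∈ S) =>
    MeasurableSpace.comap (R.σ i.1 i.2.1 i.2.2.1 i.2.2.2) inferInstance) _ h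

lemma isFresh (R : OFTPLRun X Y gx gy P P T m μ) {S : Set (Player × Stage × Fin T × Fin m)}
    {p : Player} {s : Stage} {t : Fin T} (hS : ∀ j, (p, s, t, j) ∉ S) :
    IsFresh P (R.history S) (R.σ p s t) μ := by
  intro j
  refine ⟨R.measurable_σ _ _ _ _, ?_, ?_⟩
  · cases p
    · exact R.law_minimizer s t j
    · exact R.law_maximizer s t j
  · have h := indep_iSup_of_disjoint (fun i => (R.measurable_σ _ _ _ _).comap_le) R.indep.iIndep
      (disjoint_compl_left (a := ({(p, s, t, j)} : Set (Player × Stage × Fin T × Fin m))))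
    refine indep_of_indep_of_le_right (indep_of_indep_of_le_left h ?_)
      (R.comap_le_history (Set.mem_singleton _))
    refine sup_le (R.history_mono fun i hi => ?_) (iSup₂_le fun k hk => R.comap_le_history ?_)
    · rintro rfl
      exact hS j hi
    · rintro h
      simp only [Set.mem_singleton_iff, Prod.mk.injEq, true_and] at h
      exact hk h

lemma sup_comap_le_history (R : OFTPLRun X Y gx gy P P T m μ)
    {S S' : Set (Player × Stage × Fin T × Fin m)} {p : Player} {s : Stage} {t : Fin T}
    (h : S ⊆ S') (hS' : ∀ j, (p, s, t, j) ∈ S') :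
    R.history S ⊔ ⨆ j, MeasurableSpace.comap (R.σ p s t j) inferInstance ≤ R.history S' :=
  sup_le (R.history_mono h) (iSup_le fun j => R.comap_le_history (hS' j))

/-- Perturbations of the rounds before `t`. -/
def beforeRound (T m : ℕ) (t : Fin T) : Set (Player × Stage × Fin T × Fin m) :=
  {i | i.2.2.1 < t}

/-- Perturbations drawn before the actions of round `t` are sampled. -/
def beforeAction (T m : ℕ) (t : Fin T) : Set (Player × Stage × Fin T × Fin m) :=
  {i | i.2.2.1 < t ∨ i.2.2.1 = t ∧ i.2.1 = .guess}

/-- Perturbations of the rounds up to `t`. -/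
def throughRound (T m : ℕ) (t : Fin T) : Set (Player × Stage × Fin T × Fin m) :=
  {i | i.2.2.1 ≤ t}

lemma beforeRound_subset_beforeAction (t : Fin T) : beforeRound T m t ⊆ beforeAction T m t :=
  fun _ h => Or.inl h

lemma beforeAction_subset_throughRound (t : Fin T) : beforeAction T m t ⊆ throughRound T m t :=
  fun _ h => h.elim le_of_lt fun h => h.1.le

lemma throughRound_subset_beforeRound {i t : Fin T} (h : i < t) :
    throughRound T m i ⊆ beforeRound T m t :=
  fun _ h' => lt_of_le_of_lt h' h

lemma notMem_beforeRound (p : Player) (s : Stage) (t : Fin T) (j : Fin m) :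
    (p, s, t, j) ∉ beforeRound T m t := fun h => lt_irrefl t h

lemma notMem_beforeAction (p : Player) (t : Fin T) (j : Fin m) :
    (p, Stage.action, t, j) ∉ beforeAction T m t := by
  rintro (h | h)
  · exact lt_irrefl t h
  · cases h.2

section Measurability

variable [IsProbabilityMeasure μ] [IsProbabilityMeasure P]

/-- The actions of each round are almost surely determined by the perturbations drawn so far. -/
lemma aestronglyMeasurable_aux (R : OFTPLRun X Y gx gy P P T m μ)
    (hG : IsSmoothConvexConcaveGame X Y f gx gy L) (hX : X.Nonempty) (hY : Y.Nonempty)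
    (hP : P ≪ volume) (hm : 0 < m)
    (hguess : ∀ t, R.GuessesGradientAt t ∨ R.GuessesZeroAt t) (t : Fin T)
    (hpast : ∀ i < t, AEStronglyMeasurable[R.history (throughRound T m i)] (R.x i) μ ∧
      AEStronglyMeasurable[R.history (throughRound T m i)] (R.y i) μ) :
    (AEStronglyMeasurable[R.history (beforeRound T m t)] (R.cumX t) μ ∧
      AEStronglyMeasurable[R.history (beforeRound T m t)] (R.cumY t) μ) ∧
    (AEStronglyMeasurable[R.history (beforeAction T m t)] (R.guessX t) μ ∧
      AEStronglyMeasurable[R.history (beforeAction T m t)] (R.guessY t) μ) ∧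
    (AEStronglyMeasurable[R.history (throughRound T m t)] (R.x t) μ ∧
      AEStronglyMeasurable[R.history (throughRound T m t)] (R.y t) μ) := by
  have hmem := R.ae_mem_convexHull hm
  have hloss : ∀ i < t, AEStronglyMeasurable[R.history (beforeRound T m t)] (R.lossX i) μ ∧
      AEStronglyMeasurable[R.history (beforeRound T m t)] (R.lossY i) μ := by
    intro i hi
    have hle := R.history_mono (throughRound_subset_beforeRound (m := m) hi)
    have h := hG.aestronglyMeasurable_grad ((hpast i hi).1.mono hle) ((hpast i hi).2.mono hle)
      (hmem.mono fun ω h => (h i).1) (hmem.mono fun ω h => (h i).2.1)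
    exact ⟨h.1, h.2.neg⟩
  have hcumX : AEStronglyMeasurable[R.history (beforeRound T m t)] (R.cumX t) μ :=
    aestronglyMeasurable_finsetSum _ fun i hi => (hloss i (Finset.mem_Iio.1 hi)).1
  have hcumY : AEStronglyMeasurable[R.history (beforeRound T m t)] (R.cumY t) μ :=
    aestronglyMeasurable_finsetSum _ fun i hi => (hloss i (Finset.mem_Iio.1 hi)).2
  have hle₁ := R.history_mono (beforeRound_subset_beforeAction (m := m) t)
  have hle₂ := R.history_mono (beforeAction_subset_throughRound (m := m) t)
  have hxT : AEStronglyMeasurable[R.history (beforeAction T m t)] (R.xTilde t) μ := by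
    have h := (R.isFresh (notMem_beforeRound .minimizer .guess t)).aestronglyMeasurable_average
      hG.isCompact_X hX hP (R.history_le _) hcumX (R.xTildeSample_mem_linArgmax t)
    rw [funext (R.xTilde_eq t)]
    exact h.mono (R.sup_comap_le_history (beforeRound_subset_beforeAction t)
      fun j => Or.inr ⟨rfl, rfl⟩)
  have hyT : AEStronglyMeasurable[R.history (beforeAction T m t)] (R.yTilde t) μ := by
    have h := (R.isFresh (notMem_beforeRound .maximizer .guess t)).aestronglyMeasurable_average
      hG.isCompact_Y hY hP (R.history_le _) hcumY (R.yTildeSample_mem_linArgmax t)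
    rw [funext (R.yTilde_eq t)]
    exact h.mono (R.sup_comap_le_history (beforeRound_subset_beforeAction t)
      fun j => Or.inr ⟨rfl, rfl⟩)
  have hg : AEStronglyMeasurable[R.history (beforeAction T m t)] (R.guessX t) μ ∧
      AEStronglyMeasurable[R.history (beforeAction T m t)] (R.guessY t) μ := by
    rcases hguess t with h | h
    · rw [funext fun ω => (h ω).1, funext fun ω => (h ω).2]
      exact hG.aestronglyMeasurable_grad hxT hyT (hmem.mono fun ω h => (h t).2.2.1)
        (hmem.mono fun ω h => (h t).2.2.2)
    · rw [funext fun ω => (h ω).1, funext fun ω => (h ω).2]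
      exact ⟨aestronglyMeasurable_const, aestronglyMeasurable_const⟩
  refine ⟨⟨hcumX, hcumY⟩, hg, ?_, ?_⟩
  · have h := (R.isFresh (notMem_beforeAction .minimizer t)).aestronglyMeasurable_average
      hG.isCompact_X hX hP (R.history_le _) ((hcumX.mono hle₁).add hg.1)
      (R.xSample_mem_linArgmax t)
    rw [funext (R.x_eq t)]
    exact h.mono (R.sup_comap_le_history (beforeAction_subset_throughRound t)
      fun j => le_refl t)
  · have h := (R.isFresh (notMem_beforeAction .maximizer t)).aestronglyMeasurable_average
      hG.isCompact_Y hY hP (R.history_le _) ((hcumY.mono hle₁).add hg.2.neg)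
      (R.ySample_mem_linArgmax t)
    rw [funext (R.y_eq t)]
    exact h.mono (R.sup_comap_le_history (beforeAction_subset_throughRound t)
      fun j => le_refl t)

lemma aestronglyMeasurable_action (R : OFTPLRun X Y gx gy P P T m μ)
    (hG : IsSmoothConvexConcaveGame X Y f gx gy L) (hX : X.Nonempty) (hY : Y.Nonempty)
    (hP : P ≪ volume) (hm : 0 < m)
    (hguess : ∀ t, R.GuessesGradientAt t ∨ R.GuessesZeroAt t) (t : Fin T) :
    AEStronglyMeasurable[R.history (throughRound T m t)] (R.x t) μ ∧
      AEStronglyMeasurable[R.history (throughRound T m t)] (R.y t) μ := by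
  induction t using WellFoundedLT.induction with
  | ind t ih => exact (R.aestronglyMeasurable_aux hG hX hY hP hm hguess t ih).2.2

/-- The squared deviations of the four averaged predictions of round `t` from their conditional
means. -/
noncomputable def noise (R : OFTPLRun X Y gx gy P P T m μ) (t : Fin T) (ω : Ω) : ℝ :=
  (‖R.x t ω - R.meanX t ω‖ ^ 2 + ‖R.y t ω - R.meanY t ω‖ ^ 2)
    + (‖R.xTilde t ω - meanLeader X P (R.cumX t ω)‖ ^ 2
      + ‖R.yTilde t ω - meanLeader Y P (R.cumY t ω)‖ ^ 2)

/-- The first-order effect of the sampling noise of the actions of round `t`. -/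
noncomputable def drift (R : OFTPLRun X Y gx gy P P T m μ) (t : Fin T) (ω : Ω) : ℝ :=
  ⟪gx (R.meanX t ω) (R.meanY t ω), R.x t ω - R.meanX t ω⟫_ℝ
    + ⟪-gy (R.meanX t ω) (R.meanY t ω), R.y t ω - R.meanY t ω⟫_ℝ

lemma integral_noise_le (R : OFTPLRun X Y gx gy P P T m μ)
    (hG : IsSmoothConvexConcaveGame X Y f gx gy L) (hX : X.Nonempty) (hY : Y.Nonempty)
    (hP : P ≪ volume) (hm : 0 < m)
    (hguess : ∀ t, R.GuessesGradientAt t ∨ R.GuessesZeroAt t) (t : Fin T) :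
    Integrable (R.noise t) μ ∧
      ∫ ω, R.noise t ω ∂μ ≤ 4 * (gameDiam X Y ^ 2 / m) := by
  obtain ⟨⟨hcumX, hcumY⟩, ⟨hgX, hgY⟩, -⟩ := R.aestronglyMeasurable_aux hG hX hY hP hm hguess t
    fun i _ => R.aestronglyMeasurable_action hG hX hY hP hm hguess i
  have hle := R.history_mono (beforeRound_subset_beforeAction (m := m) t)
  obtain ⟨i1, b1⟩ := (R.isFresh (notMem_beforeAction .minimizer t)).integral_norm_sq_average_sub_le
    hG.isCompact_X hX hP (R.history_le _) hm ((hcumX.mono hle).add hgX)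
    (R.xSample_mem_linArgmax t)
  obtain ⟨i2, b2⟩ := (R.isFresh (notMem_beforeAction .maximizer t)).integral_norm_sq_average_sub_le
    hG.isCompact_Y hY hP (R.history_le _) hm ((hcumY.mono hle).add hgY.neg)
    (R.ySample_mem_linArgmax t)
  obtain ⟨i3, b3⟩ :=
    (R.isFresh (notMem_beforeRound .minimizer .guess t)).integral_norm_sq_average_sub_le
    hG.isCompact_X hX hP (R.history_le _) hm hcumX (R.xTildeSample_mem_linArgmax t)
  obtain ⟨i4, b4⟩ :=
    (R.isFresh (notMem_beforeRound .maximizer .guess t)).integral_norm_sq_average_sub_le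
    hG.isCompact_Y hY hP (R.history_le _) hm hcumY (R.yTildeSample_mem_linArgmax t)
  simp only [Pi.add_apply, Pi.neg_apply, ← R.x_eq, ← R.y_eq, ← R.xTilde_eq, ← R.yTilde_eq]
    at i1 b1 i2 b2 i3 b3 i4 b4
  have hdX : Metric.diam X ^ 2 / m ≤ gameDiam X Y ^ 2 / m := by
    gcongr
    exact le_max_left _ _
  have hdY : Metric.diam Y ^ 2 / m ≤ gameDiam X Y ^ 2 / m := by
    gcongr
    exact le_max_right _ _
  have e := integral_add (i1.add i2) (i3.add i4)
  have e1 := integral_add i1 i2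
  have e2 := integral_add i3 i4
  simp only [Pi.add_apply] at e e1 e2
  refine ⟨(i1.add i2).add (i3.add i4), ?_⟩
  change ∫ ω, ((‖R.x t ω - meanLeader X P (R.cumX t ω + R.guessX t ω)‖ ^ 2
    + ‖R.y t ω - meanLeader Y P (R.cumY t ω + -R.guessY t ω)‖ ^ 2)
    + (‖R.xTilde t ω - meanLeader X P (R.cumX t ω)‖ ^ 2
      + ‖R.yTilde t ω - meanLeader Y P (R.cumY t ω)‖ ^ 2)) ∂μ ≤ _
  linarith

lemma integral_drift_eq_zero (R : OFTPLRun X Y gx gy P P T m μ)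
    (hG : IsSmoothConvexConcaveGame X Y f gx gy L) (hX : X.Nonempty) (hY : Y.Nonempty)
    (hP : P ≪ volume) (hm : 0 < m)
    (hguess : ∀ t, R.GuessesGradientAt t ∨ R.GuessesZeroAt t) (t : Fin T) :
    Integrable (R.drift t) μ ∧ ∫ ω, R.drift t ω ∂μ = 0 := by
  obtain ⟨⟨hcumX, hcumY⟩, ⟨hgX, hgY⟩, -⟩ := R.aestronglyMeasurable_aux hG hX hY hP hm hguess t
    fun i _ => R.aestronglyMeasurable_action hG hX hY hP hm hguess i
  have hle := R.history_mono (beforeRound_subset_beforeAction (m := m) t)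
  have hU := (hcumX.mono hle).add hgX
  have hV := (hcumY.mono hle).add hgY.neg
  have hmX : ∀ ω, R.meanX t ω ∈ convexHull ℝ X := fun ω =>
    meanLeader_mem_convexHull hG.isCompact_X hX hP _
  have hmY : ∀ ω, R.meanY t ω ∈ convexHull ℝ Y := fun ω =>
    meanLeader_mem_convexHull hG.isCompact_Y hY hP _
  have hmeanX : AEStronglyMeasurable[R.history (beforeAction T m t)] (R.meanX t) μ :=
    AEStronglyMeasurable.comp_measurable' (g := meanLeader X P) measurable_meanLeader hU
  have hmeanY : AEStronglyMeasurable[R.history (beforeAction T m t)] (R.meanY t) μ :=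
    AEStronglyMeasurable.comp_measurable' (g := meanLeader Y P) measurable_meanLeader hV
  obtain ⟨hwX, hwY⟩ := hG.aestronglyMeasurable_grad hmeanX hmeanY
    (Filter.Eventually.of_forall hmX) (Filter.Eventually.of_forall hmY)
  obtain ⟨A, hA⟩ := hG.isCompact_hulls.exists_bound_of_continuousOn hG.continuousOn_gradX
  obtain ⟨B, hB⟩ := hG.isCompact_hulls.exists_bound_of_continuousOn hG.continuousOn_gradY
  obtain ⟨i1, b1⟩ := (R.isFresh (notMem_beforeAction .minimizer t)).integral_inner_average_sub
    hG.isCompact_X hX hP (R.history_le _) hm hU (R.xSample_mem_linArgmax t) hwX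
    (C := A) (Filter.Eventually.of_forall fun ω => hA (_, _) ⟨hmX ω, hmY ω⟩)
  obtain ⟨i2, b2⟩ := (R.isFresh (notMem_beforeAction .maximizer t)).integral_inner_average_sub
    hG.isCompact_Y hY hP (R.history_le _) hm hV (R.ySample_mem_linArgmax t) hwY.neg
    (C := B) (Filter.Eventually.of_forall fun ω => by
      rw [Pi.neg_apply, norm_neg]; exact hB (_, _) ⟨hmX ω, hmY ω⟩)
  simp only [Pi.add_apply, Pi.neg_apply, ← R.x_eq, ← R.y_eq] at i1 b1 i2 b2
  refine ⟨i1.add i2, ?_⟩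
  have e := integral_add i1 i2
  rw [b1, b2, add_zero] at e
  exact e

end Measurability

end OFTPLRun

/-! ### The duality gap -/

namespace OFTPLRun

variable {d : ℕ} {X Y : Set (Vec d)} {f : Vec d → Vec d → ℝ} {gx gy : Vec d → Vec d → Vec d}
  {L r : ℝ} {P : Measure (Vec d)} {T m : ℕ} {Ω : Type*} [MeasurableSpace Ω] {μ : Measure Ω}

/-- The regret of both players against a fixed pair, before taking expectations. The hypothesis
`hr` makes the leaders Lipschitz with the constant needed to absorb the errors of the guesses. -/
lemma gap_le_of_run (hd : 1 ≤ d) (hT : 0 < T) (hm : 0 < m) (hL : 0 ≤ L)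
    (hG : IsSmoothConvexConcaveGame X Y f gx gy L) (hr0 : 0 < r)
    (hr : 6 * (L + 1) * (d * gameDiam X Y) ≤ r)
    (R : OFTPLRun X Y gx gy (uniformBall d r) (uniformBall d r) T m μ) (e : Fin T → ℝ)
    (hguess : ∀ t, (R.GuessesGradientAt t ∧ 0 ≤ e t) ∨ (R.GuessesZeroAt t ∧
      ∀ x ∈ convexHull ℝ X, ∀ y ∈ convexHull ℝ Y,
        gameDiam X Y * ‖gx x y‖ + gameDiam X Y * ‖gy x y‖ ≤ e t))
    {x₀ y₀ : Vec d} (hx₀ : x₀ ∈ X) (hy₀ : y₀ ∈ Y) :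
    ∀ᵐ ω ∂μ, T * (f (R.xAvg ω) y₀ - f x₀ (R.yAvg ω)) ≤
      2 * (r * gameDiam X Y) + ∑ t, (R.drift t ω + 3 * L * R.noise t ω + e t) := by
  have := isProbabilityMeasure_uniformBall (d := d) hr0
  have hP := uniformBall_absolutelyContinuous (d := d) hr0
  have hPr := ae_norm_le_uniformBall (d := d) hr0
  have hX : X.Nonempty := ⟨x₀, hx₀⟩
  have hY : Y.Nonempty := ⟨y₀, hy₀⟩
  set D := gameDiam X Y with hD
  have hDX : Metric.diam X ≤ D := le_max_left _ _
  have hDY : Metric.diam Y ≤ D := le_max_right _ _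
  have hlip : ∀ {K : Set (Vec d)}, IsCompact K → K.Nonempty → Metric.diam K ≤ D → ∀ v w,
      ‖meanLeader K (uniformBall d r) v - meanLeader K (uniformBall d r) w‖
        ≤ 1 / (6 * (L + 1)) * ‖v - w‖ := by
    intro K hK hne hKD v w
    refine (norm_meanLeader_sub_le hd hr0 hK hne v w).trans ?_
    refine mul_le_mul_of_nonneg_right ?_ (norm_nonneg _)
    rw [div_le_div_iff₀ hr0 (by positivity)]
    have : (d : ℝ) * Metric.diam K * (6 * (L + 1)) ≤ d * D * (6 * (L + 1)) := by gcongr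
    linarith
  have hsubX := smoothedSupport_subgradient hG.isCompact_X hX hP hPr
  have hsubY := smoothedSupport_subgradient hG.isCompact_Y hY hP hPr
  have hFX := meanLeader_mem_convexHull hG.isCompact_X hX hP
  have hFY := meanLeader_mem_convexHull hG.isCompact_Y hY hP
  filter_upwards [R.ae_mem_convexHull hm] with ω hω
  -- the excess loss of each round over the drop of the two potentials
  have hround : ∀ t, ⟪R.lossX t ω, R.x t ω⟫_ℝ + ⟪R.lossY t ω, R.y t ω⟫_ℝ ≤
      (smoothedSupport X (uniformBall d r) (R.cumX t ω)
        - smoothedSupport X (uniformBall d r) (R.cumX t ω + R.lossX t ω))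
      + (smoothedSupport Y (uniformBall d r) (R.cumY t ω)
        - smoothedSupport Y (uniformBall d r) (R.cumY t ω + R.lossY t ω))
      + (R.drift t ω + 3 * L * R.noise t ω + e t) := by
    intro t
    obtain ⟨hx, hy, hx', hy'⟩ := hω t
    rcases hguess t with ⟨hg, he⟩ | ⟨hg, he⟩
    · have h := hG.optimistic_round_le hL hsubX (hlip hG.isCompact_X hX hDX) hsubY
        (hlip hG.isCompact_Y hY hDY) hFX hFY (R.cumX t ω) (R.cumY t ω) hx hx' hy hy'
      rw [← (hg ω).1, ← (hg ω).2] at h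
      simp only [lossX, lossY, drift, noise, meanX, meanY]
      linarith
    · have h := hG.zeroGuess_round_le hL (D := D) hsubX hsubY hFX hFY
        (fun v w => (norm_meanLeader_sub_le_diam hG.isCompact_X hX hP v w).trans hDX)
        (fun v w => (norm_meanLeader_sub_le_diam hG.isCompact_Y hY hP v w).trans hDY)
        (R.cumX t ω) (R.cumY t ω) hx hy
      have he' := he _ hx _ hy
      simp only [lossX, lossY, drift, noise, meanX, meanY, (hg ω).1, (hg ω).2, neg_zero, add_zero]
      set A := ‖R.x t ω - meanLeader X (uniformBall d r) (R.cumX t ω)‖ ^ 2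
        + ‖R.y t ω - meanLeader Y (uniformBall d r) (R.cumY t ω)‖ ^ 2 with hA
      have hA0 : 0 ≤ A := by positivity
      set B := ‖R.xTilde t ω - meanLeader X (uniformBall d r) (R.cumX t ω)‖ ^ 2
        + ‖R.yTilde t ω - meanLeader Y (uniformBall d r) (R.cumY t ω)‖ ^ 2 with hB
      have hB0 : 0 ≤ B := by positivity
      have h1 : 2 * L * A ≤ 3 * L * (A + B) := by
        nlinarith [mul_nonneg hL hA0, mul_nonneg hL hB0]
      linarith
  have hsum := Finset.sum_le_sum fun t (_ : t ∈ Finset.univ) => hround t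
  have htelX := sum_sub_partialSum (smoothedSupport X (uniformBall d r)) fun t => R.lossX t ω
  have htelY := sum_sub_partialSum (smoothedSupport Y (uniformBall d r)) fun t => R.lossY t ω
  have hX0 := smoothedSupport_zero_sub_le hG.isCompact_X hPr (∑ t, R.lossX t ω) hx₀
  have hY0 := smoothedSupport_zero_sub_le hG.isCompact_Y hPr (∑ t, R.lossY t ω) hy₀
  have hrX : r * Metric.diam X ≤ r * D := by gcongr
  have hrY : r * Metric.diam Y ≤ r * D := by gcongr
  have hgap := hG.gap_le_regret hT (fun t => (hω t).1) (fun t => (hω t).2.1) hx₀ hy₀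
  simp only [inner_sub_right, Finset.sum_add_distrib, Finset.sum_sub_distrib] at hgap
  rw [Finset.sum_add_distrib, Finset.sum_add_distrib, Finset.sum_add_distrib] at hsum
  simp only [cumX, cumY] at hsum
  rw [htelX, htelY] at hsum
  rw [sum_inner] at hX0 hY0
  simp only [lossX, lossY] at hsum hX0 hY0
  simp only [xAvg, yAvg]
  linarith

lemma integrable_gap [IsProbabilityMeasure μ] [IsProbabilityMeasure P]
    (R : OFTPLRun X Y gx gy P P T m μ)
    (hG : IsSmoothConvexConcaveGame X Y f gx gy L) (hP : P ≪ volume) (hT : 0 < T) (hm : 0 < m)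
    (hguess : ∀ t, R.GuessesGradientAt t ∨ R.GuessesZeroAt t)
    {x₀ y₀ : Vec d} (hx₀ : x₀ ∈ X) (hy₀ : y₀ ∈ Y) :
    Integrable (fun ω => f (R.xAvg ω) y₀ - f x₀ (R.yAvg ω)) μ := by
  have hact := R.aestronglyMeasurable_action hG ⟨x₀, hx₀⟩ ⟨y₀, hy₀⟩ hP hm hguess
  have hx : AEStronglyMeasurable R.xAvg μ :=
    (aestronglyMeasurable_finsetSum Finset.univ fun t _ =>
      (hact t).1.mono (R.history_le _)).fun_const_smul _
  have hy : AEStronglyMeasurable R.yAvg μ :=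
    (aestronglyMeasurable_finsetSum Finset.univ fun t _ =>
      (hact t).2.mono (R.history_le _)).fun_const_smul _
  have hmem : ∀ᵐ ω ∂μ, R.xAvg ω ∈ convexHull ℝ X ∧ R.yAvg ω ∈ convexHull ℝ Y := by
    filter_upwards [R.ae_mem_convexHull hm] with ω hω
    exact ⟨average_mem_convexHull hT fun t => (hω t).1,
      average_mem_convexHull hT fun t => (hω t).2.1⟩
  have key : ∀ {K : Set (Vec d)} {φ : Vec d → ℝ} {u : Ω → Vec d}, IsCompact K → ContinuousOn φ K →
      AEStronglyMeasurable u μ → (∀ᵐ ω ∂μ, u ω ∈ K) → Integrable (fun ω => φ (u ω)) μ := by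
    intro K φ u hK hφ hu huK
    obtain ⟨C, hC⟩ := hK.exists_bound_of_continuousOn hφ
    refine Integrable.of_bound (aestronglyMeasurable_comp_continuousOn hK.isClosed hφ hu huK) C ?_
    filter_upwards [huK] with ω hω using hC _ hω
  refine Integrable.sub ?_ ?_
  · exact key (isCompact_convexHull hG.isCompact_X) (fun x hx' => (hG.grad_x x hx' y₀
      (subset_convexHull ℝ Y hy₀)).hasFDerivWithinAt.continuousWithinAt) hx
      (hmem.mono fun _ h => h.1)
  · exact key (isCompact_convexHull hG.isCompact_Y) (fun y hy' => (hG.grad_y x₀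
      (subset_convexHull ℝ X hx₀) y hy').hasFDerivWithinAt.continuousWithinAt) hy
      (hmem.mono fun _ h => h.2)

/-- The expected gap, for any rounds in which the guesses are the prescribed gradients or zero;
`e t` accounts for a zero guess in round `t`. -/
lemma integral_gap_le [IsProbabilityMeasure μ] (hd : 1 ≤ d) (hT : 0 < T) (hm : 0 < m) (hL : 0 ≤ L)
    (hG : IsSmoothConvexConcaveGame X Y f gx gy L) (hr0 : 0 < r)
    (hr : 6 * (L + 1) * (d * gameDiam X Y) ≤ r)
    (R : OFTPLRun X Y gx gy (uniformBall d r) (uniformBall d r) T m μ) (e : Fin T → ℝ)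
    (hguess : ∀ t, (R.GuessesGradientAt t ∧ 0 ≤ e t) ∨ (R.GuessesZeroAt t ∧
      ∀ x ∈ convexHull ℝ X, ∀ y ∈ convexHull ℝ Y,
        gameDiam X Y * ‖gx x y‖ + gameDiam X Y * ‖gy x y‖ ≤ e t))
    {x₀ y₀ : Vec d} (hx₀ : x₀ ∈ X) (hy₀ : y₀ ∈ Y) :
    Integrable (fun ω => f (R.xAvg ω) y₀ - f x₀ (R.yAvg ω)) μ ∧
    T * ∫ ω, (f (R.xAvg ω) y₀ - f x₀ (R.yAvg ω)) ∂μ ≤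
      2 * (r * gameDiam X Y) + T * (12 * L * (gameDiam X Y ^ 2 / m)) + ∑ t, e t := by
  have hprob := isProbabilityMeasure_uniformBall (d := d) hr0
  have hP := uniformBall_absolutelyContinuous (d := d) hr0
  have hguess' : ∀ t, R.GuessesGradientAt t ∨ R.GuessesZeroAt t :=
    fun t => (hguess t).imp And.left And.left
  have hgap := R.integrable_gap hG hP hT hm hguess' hx₀ hy₀
  refine ⟨hgap, ?_⟩
  have hX : X.Nonempty := ⟨x₀, hx₀⟩
  have hY : Y.Nonempty := ⟨y₀, hy₀⟩
  have hdrift := R.integral_drift_eq_zero hG hX hY hP hm hguess'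
  have hnoise := R.integral_noise_le hG hX hY hP hm hguess'
  have hterm : ∀ t, Integrable (fun ω => R.drift t ω + 3 * L * R.noise t ω + e t) μ := fun t =>
    ((hdrift t).1.add ((hnoise t).1.const_mul _)).add (integrable_const _)
  have hval : ∀ t, ∫ ω, (R.drift t ω + 3 * L * R.noise t ω + e t) ∂μ
      ≤ 12 * L * (gameDiam X Y ^ 2 / m) + e t := by
    intro t
    have h1 : Integrable (fun ω => R.drift t ω + 3 * L * R.noise t ω) μ :=
      (hdrift t).1.add ((hnoise t).1.const_mul _)
    rw [integral_add h1 (integrable_const _),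
      integral_add (hdrift t).1 ((hnoise t).1.const_mul _), integral_const_mul, (hdrift t).2]
    have h2 := mul_le_mul_of_nonneg_left (hnoise t).2 (show 0 ≤ 3 * L by positivity)
    simp only [integral_const, probReal_univ, one_smul]
    linarith
  have hsumint : Integrable (fun ω => ∑ t, (R.drift t ω + 3 * L * R.noise t ω + e t)) μ :=
    integrable_finsetSum _ fun t _ => hterm t
  have hmono := integral_mono_ae (hgap.const_mul (T : ℝ))
    ((integrable_const (2 * (r * gameDiam X Y))).add hsumint)
    (R.gap_le_of_run hd hT hm hL hG hr0 hr e hguess hx₀ hy₀)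
  rw [integral_const_mul, integral_add' (integrable_const _) hsumint,
    integral_finsetSum _ fun t _ => hterm t] at hmono
  have hs := Finset.sum_le_sum fun t (_ : t ∈ Finset.univ) => hval t
  rw [Finset.sum_add_distrib, Finset.sum_const, Finset.card_univ, Fintype.card_fin,
    nsmul_eq_mul] at hs
  simp only [integral_const, probReal_univ, one_smul] at hmono
  linarith

/-- On one-point action sets every run plays the equilibrium. -/
lemma gap_ae_eq_zero_of_gameDiam_eq_zero {P₁ P₂ : Measure (Vec d)}
    (R : OFTPLRun X Y gx gy P₁ P₂ T m μ) (hG : IsSmoothConvexConcaveGame X Y f gx gy L)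
    (hT : 0 < T) (hm : 0 < m) (hD : gameDiam X Y = 0)
    {x₀ y₀ : Vec d} (hx₀ : x₀ ∈ X) (hy₀ : y₀ ∈ Y) :
    (fun ω => f (R.xAvg ω) y₀ - f x₀ (R.yAvg ω)) =ᵐ[μ] 0 := by
  have hpoint : ∀ {K : Set (Vec d)} {z₀ : Vec d}, IsCompact K → z₀ ∈ K →
      Metric.diam K ≤ gameDiam X Y → ∀ z ∈ K, z = z₀ := by
    intro K z₀ hK hz₀ hKD z hz
    have := Metric.dist_le_diam_of_mem hK.isBounded hz hz₀
    exact dist_le_zero.1 (this.trans (hKD.trans hD.le))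
  have hT' : (T : ℝ) ≠ 0 := by positivity
  have hm' : (m : ℝ) ≠ 0 := by positivity
  filter_upwards [ae_all_iff.2 fun t => ae_all_iff.2 (R.xSample_mem t),
    ae_all_iff.2 fun t => ae_all_iff.2 (R.ySample_mem t)] with ω h1 h2
  have hx : R.xAvg ω = x₀ := by
    simp [xAvg, R.x_eq, fun t j => hpoint hG.isCompact_X hx₀ (le_max_left _ _) _ (h1 t j).1,
      ← Nat.cast_smul_eq_nsmul ℝ, smul_smul, hT', hm']
  have hy : R.yAvg ω = y₀ := by
    simp [yAvg, R.y_eq, fun t j => hpoint hG.isCompact_Y hy₀ (le_max_right _ _) _ (h2 t j).1,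
      ← Nat.cast_smul_eq_nsmul ℝ, smul_smul, hT', hm']
  simp [hx, hy]

end OFTPLRun

theorem mainTheorem1 :
    ∃ C : ℝ, 0 < C ∧
      ∀ (d T : ℕ), 1 ≤ d → 1 ≤ T →
      ∀ (X Y : Set (Vec d)) (f : Vec d → Vec d → ℝ) (gx gy : Vec d → Vec d → Vec d) (L : ℝ),
      0 ≤ L → IsSmoothConvexConcaveGame X Y f gx gy L →
      ∀ (D η : ℝ), D = gameDiam X Y → η = 6 * d * D * (L + 1) →
      ∀ {Ω : Type*} [MeasurableSpace Ω] (μ : Measure Ω) [IsProbabilityMeasure μ]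
        (R : OFTPLRun X Y gx gy (uniformBall d ((1 + (d : ℝ)⁻¹) * η))
          (uniformBall d ((1 + (d : ℝ)⁻¹) * η)) T T μ),
        (R.Optimistic → ∀ x ∈ X, ∀ y ∈ Y,
          Integrable (fun ω => f (R.xAvg ω) y - f x (R.yAvg ω)) μ ∧
          ∫ ω, (f (R.xAvg ω) y - f x (R.yAvg ω)) ∂μ ≤ C * (d * D ^ 2 * (L + 1) / T)) ∧
        (R.OptimisticZeroStart → ∀ G : ℝ,
          (∀ x ∈ convexHull ℝ X, ∀ y ∈ convexHull ℝ Y, ‖gx x y‖ ≤ G ∧ ‖gy x y‖ ≤ G) →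
          ∀ x ∈ X, ∀ y ∈ Y,
          Integrable (fun ω => f (R.xAvg ω) y - f x (R.yAvg ω)) μ ∧
          ∫ ω, (f (R.xAvg ω) y - f x (R.yAvg ω)) ∂μ
            ≤ C * ((d * D ^ 2 * (L + 1) + D * G) / T)) := by
  refine ⟨36, by norm_num, ?_⟩
  intro d T hd hT X Y f gx gy L hL hG D η hDdef hη Ω _ μ _ R
  have hT' : (0 : ℝ) < T := by exact_mod_cast hT
  have hd' : (1 : ℝ) ≤ d := by exact_mod_cast hd
  have hD0 : 0 ≤ D := hDdef ▸ Metric.diam_nonneg.trans (le_max_left _ _)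
  -- for `D = 0` the perturbations have no density, but the action sets are single points
  rcases hD0.eq_or_lt with hD | hDpos
  · have hzero : ∀ x ∈ X, ∀ y ∈ Y,
        Integrable (fun ω => f (R.xAvg ω) y - f x (R.yAvg ω)) μ ∧
          ∫ ω, (f (R.xAvg ω) y - f x (R.yAvg ω)) ∂μ = 0 := by
      intro x hx y hy
      have h := R.gap_ae_eq_zero_of_gameDiam_eq_zero hG hT hT (hDdef ▸ hD.symm) hx hy
      exact ⟨(integrable_zero _ _ _).congr h.symm, integral_eq_zero_of_ae h⟩
    refine ⟨fun _ x hx y hy => ⟨(hzero x hx y hy).1, ?_⟩,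
      fun _ G _ x hx y hy => ⟨(hzero x hx y hy).1, ?_⟩⟩ <;>
    simp [(hzero x hx y hy).2, ← hD]
  have hrval : (1 + (d : ℝ)⁻¹) * η = 6 * (d + 1) * D * (L + 1) := by
    rw [hη]; field_simp
  have hr0 : 0 < (1 + (d : ℝ)⁻¹) * η := by rw [hrval]; positivity
  have hr1 : 6 * (L + 1) * (d * gameDiam X Y) ≤ (1 + (d : ℝ)⁻¹) * η := by
    rw [hrval, ← hDdef]
    nlinarith [mul_nonneg hD0 (add_nonneg hL zero_le_one)]
  -- the total cost of perturbation and sampling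
  have hcost : 2 * ((1 + (d : ℝ)⁻¹) * η * D) + T * (12 * L * (D ^ 2 / T))
      ≤ 36 * (d * D ^ 2 * (L + 1)) := by
    -- averaging as many samples as there are rounds leaves a noise of order one in total
    have h1 : (T : ℝ) * (12 * L * (D ^ 2 / T)) = 12 * (1 * D ^ 2 * L) := by field_simp
    have h2 : 12 * (1 * D ^ 2 * L) ≤ 12 * (d * D ^ 2 * (L + 1)) := by gcongr; linarith
    have h3 : (1 + (d : ℝ)⁻¹) * η * D ≤ 12 * (d * D ^ 2 * (L + 1)) := by
      rw [hrval]
      calc 6 * (d + 1) * D * (L + 1) * D = 6 * ((d + 1) * D ^ 2 * (L + 1)) := by ring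
        _ ≤ 6 * ((d + d) * D ^ 2 * (L + 1)) := by gcongr
        _ = 12 * (d * D ^ 2 * (L + 1)) := by ring
    rw [h1]
    linarith
  constructor
  · intro hopt x hx y hy
    obtain ⟨h1, h2⟩ := R.integral_gap_le hd hT hT hL hG hr0 hr1 (fun _ => 0)
      (fun t => Or.inl ⟨hopt t, le_rfl⟩) hx hy
    refine ⟨h1, ?_⟩
    rw [← hDdef, Finset.sum_const_zero] at h2
    rw [← mul_div_assoc, le_div_iff₀ hT', mul_comm]
    linarith
  · intro hopt G hGb x hx y hy
    obtain ⟨h1, h2⟩ := R.integral_gap_le hd hT hT hL hG hr0 hr1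
      (fun t => if t = ⟨0, hT⟩ then 2 * (D * G) else 0)
      (fun t => by
        by_cases ht : t = ⟨0, hT⟩
        · refine Or.inr ⟨fun ω => (hopt t ω).1 (by simp [ht]), fun x' hx' y' hy' => ?_⟩
          have hb := hGb x' hx' y' hy'
          rw [if_pos ht, ← hDdef]
          have e1 : D * ‖gx x' y'‖ ≤ D * G := by gcongr; exact hb.1
          have e2 : D * ‖gy x' y'‖ ≤ D * G := by gcongr; exact hb.2
          linarith
        · refine Or.inl ⟨fun ω => (hopt t ω).2 fun h => ht (Fin.ext h), ?_⟩
          rw [if_neg ht]) hx hy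
    refine ⟨h1, ?_⟩
    have hG0 : 0 ≤ G := (norm_nonneg _).trans
      (hGb x (subset_convexHull ℝ X hx) y (subset_convexHull ℝ Y hy)).1
    rw [← hDdef, Finset.sum_ite_eq' Finset.univ, if_pos (Finset.mem_univ _)] at h2
    rw [← mul_div_assoc, le_div_iff₀ hT', mul_comm]
    have := mul_nonneg hD0 hG0
    linarith
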